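/- Fix a positive integer $k$. For a positive integer $\ell$ let $\mathcal A(\ell)$ be the space of weight-$k$ holomorphic cusp forms on $\Gamma_0(\ell)$, a finite-dimensional complex vector space. Fix $V>0$ and equip $\mathcal A(\ell)$ with the Petersson inner product $\langle f,g\rangle_\ell=\int_{\Gamma_0(\ell)\backslash\mathbb H}\overline{f(z)}\,g(z)\,y^k\,d\mu_\ell(z)$, where $\mu_\ell$ is the multiple of the hyperbolic measure $dx\,dy/y^2$ for which $\Gamma_0(\ell)\backslash\mathbb H$ has total volume $V$ (the same $V$ for all $\ell$; for instance $V=1$). For a positive integer $d$ put $\varphi|_d(z):=d^{k/2}\varphi(dz)$. The oldspace of level $q$ is the span in $\mathcal A(q)$ of the forms $\varphi|_d$ with $\varphi\in\mathcal A(\ell)$, $\ell\mid q$, $\ell\neq q$, $d\mid q/\ell$, and the newspace $\mathcal A^*(q)$ is its orthogonal complement in $\mathcal A(q)$. Let $q$ be a positive integer such that $p^3\mid q$ for every prime $p\mid q$. Let $\mathcal B^*(q)$ be an arbitrary orthonormal basis of $\mathcal A^*(q)$ and, for each $\ell\mid q$, let $\mathcal B(\ell)$ be an arbitrary orthonormal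 basis of $\mathcal A(\ell)$. These bases are finite, and for all $z_1,z_2$ in the upper half-plane $$\sum_{\varphi\in\mathcal B^*(q)}\varphi(z_1)\overline{\varphi(z_2)}=\sum_{d,e\mid q}\mu(d)\mu(e)\sum_{\varphi\in\mathcal B(q/(de))}\varphi|_d(z_1)\,\overline{\varphi|_d(z_2)},$$ where $\mu$ is the Möbius function and the terms with $\mu(d)\mu(e)=0$ are read as zero (for $d,e$ squarefree one has $de\mid q$). Equivalently, let $E_{d..de}$, for squarefree $d,e\mid q$, denote the orthogonal projector of $\mathcal A(q)$ onto the subspace $\{\varphi|_d:\varphi\in\mathcal A(q/(de))\}$. These projectors exist, and $\sum_{d,e\mid q}\mu(d)\mu(e)E_{d..de}$ is the orthogonal projector of $\mathcal A(q)$ onto $\mathcal A^*(q)$. -/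

import Mathlib

open UpperHalfPlane MeasureTheory CongruenceSubgroup
open scoped MatrixGroups Modular ComplexConjugate

noncomputable section

namespace NewformKernel

/-- The space of holomorphic cusp forms of weight `k` on `Γ₀(ℓ)`. -/
abbrev A (k ℓ : ℕ) : Type :=
  CuspForm ((Gamma0 ℓ).map (Matrix.SpecialLinearGroup.mapGL ℝ)) (k : ℤ)

/-- A fundamental domain for `Γ₀(ℓ)` acting on `ℍ`: the union of the translates `g⁻¹ 𝒟` of the
standard fundamental domain `𝒟` of `SL(2, ℤ)`, where `g` runs over representatives of the cosets
`g Γ₀(ℓ)` in `SL(2, ℤ)`. -/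
def fundDomain (ℓ : ℕ) : Set ℍ :=
  ⋃ c : SL(2, ℤ) ⧸ Gamma0 ℓ, {τ : ℍ | c.out • τ ∈ 𝒟}

/-- The Petersson inner product on level `ℓ`, conjugate-linear in the first variable, with respect
to the multiple of the hyperbolic measure `dx dy / y ^ 2` (which is `volume` on `ℍ`) that gives
`Γ₀(ℓ) \ ℍ` total volume `V`. -/
def inner (V : ℝ) {k ℓ : ℕ} (f g : A k ℓ) : ℂ :=
  (V : ℂ) * ⨍ τ in fundDomain ℓ, petersson (k : ℤ) f g τ

/-- `φ|_d (z) = d ^ (k / 2) φ(d z)`. -/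
def raise {k ℓ : ℕ} (d : ℕ) (φ : A k ℓ) : ℍ → ℂ := fun z ↦
  (((d : ℝ) ^ ((k : ℝ) / 2) : ℝ) : ℂ) * φ (ofComplex ((d : ℂ) * (z : ℂ)))

/-- The forms `φ|_d` of level `q`, with `φ` a cusp form of level `ℓ`. -/
def raised (k q ℓ d : ℕ) : Set (A k q) :=
  {f | ∃ φ : A k ℓ, (f : ℍ → ℂ) = raise d φ}

/-- The oldspace: the span of all `φ|_d` with `φ` of level `ℓ`, where `ℓ` runs over the proper
divisors of `q` and `d` over the divisors of `q / ℓ`. -/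
def oldspace (k q : ℕ) : Submodule ℂ (A k q) :=
  Submodule.span ℂ {f | ∃ ℓ d : ℕ, ℓ ∣ q ∧ ℓ ≠ q ∧ d ∣ q / ℓ ∧ f ∈ raised k q ℓ d}

/-- The newspace: the orthogonal complement of the oldspace. -/
def newspace (V : ℝ) (k q : ℕ) : Set (A k q) :=
  {f | ∀ g ∈ oldspace k q, inner V g f = 0}

/-- `B` is an orthonormal basis of the subspace `W`. -/
def IsOrthonormalBasis (V : ℝ) {k ℓ : ℕ} (B W : Set (A k ℓ)) : Prop :=
  (∀ φ ∈ B, inner V φ φ = 1) ∧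
  (∀ φ ∈ B, ∀ ψ ∈ B, φ ≠ ψ → inner V φ ψ = 0) ∧
  (Submodule.span ℂ B : Set (A k ℓ)) = W

/-- `E` is the orthogonal projector onto the subspace `W`. -/
def IsOrthogonalProjector (V : ℝ) {k ℓ : ℕ} (E : A k ℓ →ₗ[ℂ] A k ℓ) (W : Set (A k ℓ)) : Prop :=
  ∀ f : A k ℓ, E f ∈ W ∧ ∀ w ∈ W, inner V w (f - E f) = 0

end NewformKernel

end

/-! The claim about kernels follows from the one about projectors. If `E` is the orthogonal
projector onto a subspace, the kernel of any orthonormal basis of that subspace equals `∑ E ψ(z₁)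
conj (ψ(z₂))`, with `ψ` running over one fixed orthonormal basis of level `q`
(`IsOrthonormalBasis.kernel_eq`). This is linear in `E`. Moreover `φ ↦ φ|_d` is an isometry for the
normalised inner products (`inner_raiseLin`), so it carries orthonormal bases of level `q/(de)` to
orthonormal bases of the raised space.

Let `P` be the Möbius combination of projectors. The term `d = e = 1` is the identity and every
other nonzero term takes values in the oldspace, so `f - P f` is orthogonal to newforms. It remains
to show that `P f` is orthogonal to the oldspace, which is spanned by the forms raised from level
`q/p`, trivially or by `p`, for primes `p ∣ q` (`mem_newspace_iff`).

Fix such a `p`. A form raised by `p` is invariant under translation by `1/p`, so replacing `f` by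
its average over the translations `b/p` leaves its inner product with that form unchanged. If `p ∤
d`, this average maps the space of `E d e` into that of `E (d * p) e`, so `E (d * p) e f` is the
average of `E d e f`. The terms `d` and `dp` have opposite Möbius signs and cancel. For forms of
level `q/p`, the same argument runs in `e`, with lower unipotents whose entries are multiples of
`q/p` (`inner_apply_mul_left`, `inner_apply_mul_right`).

The averages are traces over exactly `p` cosets only if `p` still divides the level reached, namely
`q/(dep)` with `p ∤ d` or `p ∤ e`. The hypothesis `p ^ 3 ∣ q` guarantees this
(`mul_mul_dvd_of_squarefree`). -/

section

open scoped Pointwise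

/-! ### Averages of invariant functions over fundamental domains -/

namespace MeasureTheory.IsFundamentalDomain

variable {G H α E : Type*} [Group G] [Group H] [MulAction G α] [MulAction H α]
  [MeasurableSpace α] {μ : Measure α} {s t : Set α}
  [MeasurableConstSMul G α] [SMulInvariantMeasure G α μ]
  [MeasurableConstSMul H α] [SMulInvariantMeasure H α μ]

/-- If `H` acts through an embedding into `G`, translates of a fundamental domain of `G` by
coset representatives form a fundamental domain of `H`. -/
theorem iUnion_quotient_out [Countable G] (hs : IsFundamentalDomain G s μ) (φ : H →* G)
    (hφ : Function.Injective φ) (hact : ∀ (h : H) (x : α), φ h • x = h • x) :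
    IsFundamentalDomain H (⋃ c : G ⧸ φ.range, (c.out)⁻¹ • s) μ := by
  have : Countable (G ⧸ φ.range) := Quotient.countable
  refine mk'' (.iUnion fun c ↦ hs.nullMeasurableSet_smul _) ?_ ?_
    fun g ↦ (measurePreserving_smul g μ).quasiMeasurePreserving
  · filter_upwards [hs.ae_covers] with x ⟨g, hg⟩
    obtain ⟨⟨_, h, rfl⟩, hh⟩ := QuotientGroup.mk_out_eq_mul φ.range g
    refine ⟨h⁻¹, Set.mem_iUnion.2 ⟨(g : G ⧸ φ.range), ?_⟩⟩
    rw [Set.mem_smul_set_iff_inv_smul_mem, inv_inv, hh, ← hact, ← mul_smul]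
    simpa using hg
  · intro h hh
    simp only [Set.smul_set_iUnion, AEDisjoint.iUnion_left_iff, AEDisjoint.iUnion_right_iff]
    intro c' c
    have hset : h • (c.out)⁻¹ • s = (φ h * (c.out)⁻¹) • s := by
      rw [mul_smul]
      ext x
      simp only [Set.mem_smul_set_iff_inv_smul_mem, ← map_inv, hact]
    rw [hset]
    refine hs.aedisjoint fun heq ↦ hh ?_
    have h1 : c.out = c'.out * φ h := by
      rw [← mul_right_inj (φ h * c.out⁻¹)]
      nth_rw 2 [heq]
      group
    have h2 : c = c' := by
      rw [← QuotientGroup.out_eq' c, ← QuotientGroup.out_eq' c', h1]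
      exact QuotientGroup.mk_mul_of_mem _ ⟨h, rfl⟩
    rw [h2] at h1
    exact hφ (by simpa using h1.symm)

/-- The average of a `G`-invariant function is the same over a fundamental domain of `G` and over
a fundamental domain of finite measure of a group embedded in `G`. -/
theorem setAverage_eq_of_injective [Countable G] [Countable H] [NormedAddCommGroup E]
    [NormedSpace ℝ E] (hμ : μ ≠ 0)
    (hs : IsFundamentalDomain G s μ) (ht : IsFundamentalDomain H t μ) (φ : H →* G)
    (hφ : Function.Injective φ) (hact : ∀ (h : H) (x : α), φ h • x = h • x) (htop : μ t ≠ ⊤)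
    {f : α → E} (hf : ∀ (g : G) x, f (g • x) = f x) (hintg : IntegrableOn f t μ) :
    ⨍ x in t, f x ∂μ = ⨍ x in s, f x ∂μ := by
  have : Countable (G ⧸ φ.range) := Quotient.countable
  have ht' := hs.iUnion_quotient_out φ hφ hact
  have hfH : ∀ (h : H) x, f (h • x) = f x := fun h x ↦ by rw [← hact, hf]
  have hdisj : Pairwise (Function.onFun (AEDisjoint μ)
      fun c : G ⧸ φ.range ↦ (c.out)⁻¹ • s) := fun c c' hc ↦
    hs.aedisjoint fun h ↦ hc (Quotient.out_injective (inv_injective h))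
  have hnull : ∀ c : G ⧸ φ.range, NullMeasurableSet ((c.out)⁻¹ • s) μ :=
    fun c ↦ hs.nullMeasurableSet_smul _
  have hvol : μ t = ∑' _ : G ⧸ φ.range, μ s := by
    rw [ht.measure_eq ht', measure_iUnion₀ hdisj hnull]
    simp
  -- Infinitely many almost disjoint copies of `s`, each of the same nonzero measure, would give `t`
  -- infinite measure.
  have hfin : Finite (G ⧸ φ.range) := by
    by_contra hinf
    rw [not_finite_iff_infinite] at hinf
    exact htop (hvol.trans (ENNReal.tsum_const_eq_top_of_ne_zero (hs.measure_ne_zero hμ)))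
  let := Fintype.ofFinite (G ⧸ φ.range)
  rw [tsum_fintype, Finset.sum_const, Finset.card_univ, nsmul_eq_mul] at hvol
  have hI : ∫ x in t, f x ∂μ = Fintype.card (G ⧸ φ.range) • ∫ x in s, f x ∂μ := by
    rw [ht.setIntegral_eq ht' hfH, integral_iUnion_ae hnull hdisj
      ((ht.integrableOn_iff ht' hfH).1 hintg), tsum_fintype,
      Finset.sum_congr rfl fun c _ ↦ (hs.smul (c.out)⁻¹).setIntegral_eq hs hf]
    simp
  have hcard : (Fintype.card (G ⧸ φ.range) : ℝ) ≠ 0 := by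
    simp [Fintype.card_ne_zero]
  rw [setAverage_eq, setAverage_eq, hI, measureReal_def, hvol, ENNReal.toReal_mul,
    ENNReal.toReal_natCast, ← Nat.cast_smul_eq_nsmul ℝ, smul_smul, ← measureReal_def, mul_inv]
  congr 1
  field_simp

end MeasureTheory.IsFundamentalDomain

end

noncomputable section

namespace NewformKernel

open scoped Pointwise
open Matrix.SpecialLinearGroup (mapGL)

/-! ### Fundamental domains for subgroups of the modular group -/

instance : Countable SL(2, ℤ) :=
  Function.Injective.countable (f := fun g : SL(2, ℤ) ↦ fun i j ↦ g.1 i j)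
    fun _ _ h ↦ Subtype.ext h

/-- The domain lies in the strip `|x| ≤ 1/2`, `y > 1/2`, on which `dx dy / y ^ 2` has finite mass.
-/
theorem volume_fd_lt_top : volume 𝒟 < (⊤ : ENNReal) := by
  set S : Set (ℝ × ℝ) := Set.Icc (-(1 / 2)) (1 / 2) ×ˢ Set.Ioi (1 / 2) with hS
  have hsub : UpperHalfPlane.coe '' 𝒟 ⊆ Complex.measurableEquivRealProd ⁻¹' S := by
    rintro _ ⟨τ, hτ, rfl⟩
    have h1 := ModularGroup.three_le_four_mul_im_sq_of_mem_fd hτ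
    have h2 := abs_le.1 hτ.2
    have h3 := τ.im_pos
    simp only [hS, Set.mem_preimage, Complex.measurableEquivRealProd_apply, Set.mem_prod,
      Set.mem_Icc, Set.mem_Ioi, coe_re, coe_im]
    refine ⟨h2, ?_⟩
    nlinarith
  rw [volume_eq_lintegral]
  refine (lintegral_mono_set hsub).trans_lt ?_
  have h := Complex.volume_preserving_equiv_real_prod.setLIntegral_comp_preimage_emb
    Complex.measurableEquivRealProd.measurableEmbedding
    (fun p : ℝ × ℝ ↦ (((1 / ‖p.2‖₊) ^ 2 : NNReal) : ENNReal)) S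
  simp only [Complex.measurableEquivRealProd_apply] at h
  rw [h, Measure.volume_eq_prod, hS, ← Measure.prod_restrict]
  have h2 := lintegral_prod_mul (μ := (volume : Measure ℝ).restrict (Set.Icc (-(1 / 2)) (1 / 2)))
    (ν := (volume : Measure ℝ).restrict (Set.Ioi (1 / 2))) (f := fun _ ↦ 1)
    (g := fun y : ℝ ↦ (((1 / ‖y‖₊) ^ 2 : NNReal) : ENNReal)) (by fun_prop) (by fun_prop)
  simp only [one_mul] at h2
  rw [h2]
  refine ENNReal.mul_lt_top (by simp) ?_
  have h3 := (integrableOn_Ioi_rpow_of_lt (a := -2) (c := 1 / 2) (by norm_num)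
    (by norm_num)).hasFiniteIntegral
  rw [hasFiniteIntegral_iff_enorm] at h3
  refine lt_of_le_of_lt (le_of_eq (setLIntegral_congr_fun measurableSet_Ioi fun y hy ↦ ?_)) h3
  have hy' : (0 : ℝ) < y := lt_trans (by norm_num) (Set.mem_Ioi.1 hy)
  rw [← ofReal_norm, Real.norm_of_nonneg (by positivity), Real.rpow_neg hy'.le,
    ← ENNReal.ofReal_coe_nnreal]
  congr 1
  push_cast
  rw [Real.norm_of_nonneg hy'.le]
  norm_num

/-- Needed for definiteness of the Petersson product: a null open set is empty. -/
instance : (volume : Measure ℍ).IsOpenPosMeasure where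
  open_pos U hU hne h := by
    have hopen : IsOpen (UpperHalfPlane.coe '' U) := isOpenEmbedding_coe.isOpenMap U hU
    refine hopen.measure_ne_zero volume (hne.image _) ?_
    rw [volume_eq_lintegral, setLIntegral_eq_zero_iff hopen.measurableSet (by fun_prop)] at h
    rw [measure_eq_zero_iff_ae_notMem]
    filter_upwards [h] with z hz hz'
    obtain ⟨τ, hτ, rfl⟩ := hz'
    have := hz ⟨τ, hτ, rfl⟩
    simp [τ.im_ne_zero] at this

theorem volume_ne_zero_upperHalfPlane : (volume : Measure ℍ) ≠ 0 := by
  have : Nonempty ℍ := ⟨I⟩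
  exact NeZero.ne _

theorem volume_eq_zero_of_image_coe {s : Set ℍ} (h : volume (UpperHalfPlane.coe '' s) = 0) :
    volume s = 0 := by
  rw [volume_eq_lintegral, setLIntegral_measure_zero _ _ h]

theorem volume_re_eq (x : ℝ) : volume {z : ℂ | z.re = x} = 0 := by
  have h := Complex.volume_preserving_equiv_real_prod.measure_preimage_emb
    Complex.measurableEquivRealProd.measurableEmbedding ({x} ×ˢ Set.univ)
  rw [Measure.volume_eq_prod, Measure.prod_prod, Real.volume_singleton, zero_mul] at h
  convert h using 2
  ext z
  simp

theorem volume_fd_diff_fdo : volume (𝒟 \ 𝒟ᵒ) = 0 := by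
  apply volume_eq_zero_of_image_coe
  have hsub : UpperHalfPlane.coe '' (𝒟 \ 𝒟ᵒ) ⊆
      Metric.sphere 0 1 ∪ ({z : ℂ | z.re = 1 / 2} ∪ {z : ℂ | z.re = -(1 / 2)}) := by
    rintro _ ⟨τ, ⟨h1, h2⟩, rfl⟩
    by_cases h3 : Complex.normSq τ = 1
    · left
      rw [Complex.normSq_eq_norm_sq] at h3
      simpa using (pow_eq_one_iff_of_nonneg (norm_nonneg _) two_ne_zero).1 h3
    · right
      have h4 : 1 < Complex.normSq (τ : ℂ) := lt_of_le_of_ne h1.1 (Ne.symm h3)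
      have h5 : |τ.re| = 1 / 2 := le_antisymm h1.2 (not_lt.1 fun h ↦ h2 ⟨h4, h⟩)
      exact (abs_eq (by norm_num)).1 h5
  refine measure_mono_null hsub (measure_union_null (Measure.addHaar_sphere _ _ _)
    (measure_union_null (volume_re_eq _) (volume_re_eq _)))

/-- The group of transformations of `ℍ` induced by `GL(2, ℝ)`; it acts faithfully. -/
abbrev Moeb : Subgroup (Equiv.Perm ℍ) := (MulAction.toPermHom (GL (Fin 2) ℝ) ℍ).range

/-- The transformation of `ℍ` induced by an invertible matrix. -/
def toMoeb : GL (Fin 2) ℝ →* Moeb := (MulAction.toPermHom (GL (Fin 2) ℝ) ℍ).rangeRestrict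

theorem toMoeb_surjective : Function.Surjective toMoeb := MonoidHom.rangeRestrict_surjective _

instance : MeasurableConstSMul Moeb ℍ where
  measurable_const_smul c := by
    obtain ⟨g, rfl⟩ := toMoeb_surjective c
    exact measurable_const_smul g

instance : SMulInvariantMeasure Moeb ℍ volume where
  measure_preimage_smul c s hs := by
    obtain ⟨g, rfl⟩ := toMoeb_surjective c
    exact measure_preimage_smul_of_nullMeasurableSet (μ := volume) hs.nullMeasurableSet g

/-- The fundamental domain for a subgroup of `SL(2, ℤ)` made of translates of `𝒟`. -/
def fdOf (Γ : Subgroup SL(2, ℤ)) : Set ℍ := ⋃ c : SL(2, ℤ) ⧸ Γ, {τ : ℍ | c.out • τ ∈ 𝒟}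

theorem fundDomain_eq_fdOf (ℓ : ℕ) : fundDomain ℓ = fdOf (Gamma0 ℓ) := rfl

/-- The image of a subgroup of `SL(2, ℤ)` in the group of transformations of `ℍ`. -/
def moeb (Γ : Subgroup SL(2, ℤ)) : Subgroup Moeb := (Γ.map (mapGL ℝ)).map toMoeb

theorem mem_moeb {Γ : Subgroup SL(2, ℤ)} {c : Moeb} :
    c ∈ moeb Γ ↔ ∃ γ ∈ Γ, toMoeb (mapGL ℝ γ) = c := by
  simp [moeb]

instance (Γ : Subgroup SL(2, ℤ)) : Countable (moeb Γ) := by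
  refine Function.Surjective.countable (f := fun γ : Γ ↦
    (⟨toMoeb (mapGL ℝ γ.1), mem_moeb.2 ⟨γ, γ.2, rfl⟩⟩ : moeb Γ)) ?_
  rintro ⟨c, hc⟩
  obtain ⟨γ, hγ, rfl⟩ := mem_moeb.1 hc
  exact ⟨⟨γ, hγ⟩, rfl⟩

theorem measurable_sl_smul (g : SL(2, ℤ)) : Measurable (fun τ : ℍ ↦ g • τ) :=
  measurable_const_smul (mapGL ℝ g)

theorem measure_preimage_sl_smul (g : SL(2, ℤ)) (s : Set ℍ) :
    volume {τ : ℍ | g • τ ∈ s} = volume s :=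
  measure_preimage_smul (μ := (volume : Measure ℍ)) (mapGL ℝ g) s

theorem measurableSet_fdOf (Γ : Subgroup SL(2, ℤ)) : MeasurableSet (fdOf Γ) := by
  have : Countable (SL(2, ℤ) ⧸ Γ) := Quotient.countable
  exact .iUnion fun c ↦ measurable_sl_smul _ ModularGroup.isClosed_fd.measurableSet

theorem volume_fdOf_lt_top (Γ : Subgroup SL(2, ℤ)) [Γ.FiniteIndex] : volume (fdOf Γ) < ⊤ := by
  have : Finite (SL(2, ℤ) ⧸ Γ) := inferInstance
  let := Fintype.ofFinite (SL(2, ℤ) ⧸ Γ)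
  refine (measure_iUnion_le _).trans_lt ?_
  rw [tsum_fintype]
  exact ENNReal.sum_lt_top.2 fun c _ ↦ by
    rw [measure_preimage_sl_smul]
    exact volume_fd_lt_top

/-- Almost every point of `ℍ` has all its `SL(2, ℤ)`-translates off the boundary of `𝒟`. -/
theorem ae_smul_mem_fdo : ∀ᵐ τ : ℍ, ∀ g : SL(2, ℤ), g • τ ∈ 𝒟 → g • τ ∈ 𝒟ᵒ := by
  rw [ae_all_iff]
  intro g
  have h := (measure_preimage_sl_smul g (𝒟 \ 𝒟ᵒ)).trans volume_fd_diff_fdo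
  rw [measure_eq_zero_iff_ae_notMem] at h
  filter_upwards [h] with τ hτ h1
  by_contra h2
  exact hτ ⟨h1, h2⟩

/-- An element of `SL(2, ℤ)` moving a point of `𝒟ᵒ` into `𝒟` is `±1`, and almost every orbit avoids
the boundary. Since `-1 ∈ Γ`, the sign does not change the coset. The group must be `moeb Γ` rather
than `Γ`, because `-1` acts trivially and would violate disjointness. -/
theorem isFundamentalDomain_fdOf {Γ : Subgroup SL(2, ℤ)} (hneg : -1 ∈ Γ) :
    IsFundamentalDomain (moeb Γ) (fdOf Γ) := by
  refine .mk'' (measurableSet_fdOf Γ).nullMeasurableSet ?_ ?_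
    fun g ↦ (measurePreserving_smul g volume).quasiMeasurePreserving
  · refine .of_forall fun τ ↦ ?_
    obtain ⟨g, hg⟩ := ModularGroup.exists_smul_mem_fd τ
    obtain ⟨⟨h, hh⟩, hout⟩ := QuotientGroup.mk_out_eq_mul Γ g
    refine ⟨⟨toMoeb (mapGL ℝ h⁻¹), mem_moeb.2 ⟨_, inv_mem hh, rfl⟩⟩,
      Set.mem_iUnion.2 ⟨(g : SL(2, ℤ) ⧸ Γ), ?_⟩⟩
    change (g : SL(2, ℤ) ⧸ Γ).out • h⁻¹ • τ ∈ 𝒟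
    rw [hout, ← mul_smul]
    simpa using hg
  · rintro ⟨c, hc⟩ hne
    obtain ⟨γ, hγ, rfl⟩ := mem_moeb.1 hc
    rw [AEDisjoint, measure_eq_zero_iff_ae_notMem]
    filter_upwards [ae_smul_mem_fdo] with τ hτ hmem
    obtain ⟨h1, h2⟩ := hmem
    rw [Set.mem_smul_set_iff_inv_smul_mem] at h1
    obtain ⟨c, hc1⟩ := Set.mem_iUnion.1 h1
    obtain ⟨c', hc2⟩ := Set.mem_iUnion.1 h2
    have h3 : (toMoeb (mapGL ℝ γ))⁻¹ • τ = γ⁻¹ • τ := by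
      rw [← map_inv, ← map_inv]; rfl
    change c.out • ((toMoeb (mapGL ℝ γ))⁻¹ • τ) ∈ 𝒟 at hc1
    change c'.out • τ ∈ 𝒟 at hc2
    rw [h3, ← mul_smul] at hc1
    have h4 : (c.out * γ⁻¹ * c'.out⁻¹) • (c'.out • τ) ∈ 𝒟 := by
      rw [← mul_smul]
      simpa using hc1
    have h5 : c.out * γ⁻¹ * c'.out⁻¹ = 1 ∨ c.out * γ⁻¹ * c'.out⁻¹ = -1 :=
      ModularGroup.eq_one_or_neg_one_of_mem_fdo_mem_fd (hτ _ hc2) h4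
    have h6 : c = c' := by
      rw [← QuotientGroup.out_eq' c, ← QuotientGroup.out_eq' c', QuotientGroup.eq]
      rcases h5 with h5 | h5
      · rw [mul_inv_eq_one] at h5
        rw [← h5]
        simpa using hγ
      · have : c'.out = -(c.out * γ⁻¹) := by
          rw [mul_inv_eq_iff_eq_mul] at h5
          rw [h5]; simp
        rw [this, mul_neg, ← neg_one_mul]
        exact mul_mem hneg (by simpa using hγ)
    subst h6
    have h7 : γ = 1 ∨ γ = -1 := by
      rcases h5 with h5 | h5
      · left
        simpa using h5
      · right
        rw [mul_inv_eq_iff_eq_mul, neg_one_mul, ← mul_neg_one, mul_right_inj,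
          inv_eq_iff_eq_inv] at h5
        rw [h5]
        simp
    apply hne
    ext1
    rcases h7 with rfl | rfl
    · simp
    · apply Subtype.ext
      ext τ'
      change (((-1 : SL(2, ℤ)) • τ' : ℍ) : ℂ) = τ'
      simp

/-- The mean of an invariant function does not change on passing to a translate, computed on a
possibly smaller group. -/
theorem setAverage_fdOf_smul {Γ₁ Γ₂ : Subgroup SL(2, ℤ)} [Γ₁.FiniteIndex]
    (h₁ : -1 ∈ Γ₁) (h₂ : -1 ∈ Γ₂) (g : GL (Fin 2) ℝ)
    (hg : ∀ γ ∈ Γ₁, ∃ δ ∈ Γ₂, mapGL ℝ δ = g * mapGL ℝ γ * g⁻¹) {h : ℍ → ℂ}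
    (hinv : ∀ γ ∈ Γ₂, ∀ τ : ℍ, h (γ • τ) = h τ) (hcont : Continuous h) {C : ℝ}
    (hbdd : ∀ τ, ‖h τ‖ ≤ C) :
    ⨍ τ in fdOf Γ₁, h (g • τ) = ⨍ τ in fdOf Γ₂, h τ := by
  have hf₁ := isFundamentalDomain_fdOf h₁
  have hf₂ := isFundamentalDomain_fdOf h₂
  -- The translate of `fdOf Γ₁` by `g` is a fundamental domain for the conjugate of `moeb Γ₁`, which
  -- lies in `moeb Γ₂`. The comparison of averages for nested groups then applies.
  set c : Moeb ≃* Moeb := MulAut.conj (toMoeb g)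
  set e : (moeb Γ₁) ≃* (moeb Γ₁).map c.toMonoidHom :=
    (moeb Γ₁).equivMapOfInjective c.toMonoidHom c.injective
  have hmp : MeasurePreserving (fun τ : ℍ ↦ g • τ) := measurePreserving_smul g volume
  have hemb : MeasurableEmbedding (fun τ : ℍ ↦ g • τ) := measurableEmbedding_const_smul g
  have hcount : Countable ((moeb Γ₁).map c.toMonoidHom) := 
    e.symm.toEquiv.countable_iff.2 inferInstance
  have hf₃ : IsFundamentalDomain ((moeb Γ₁).map c.toMonoidHom)
      ((MulAction.toPerm g : Equiv.Perm ℍ) '' fdOf Γ₁) := by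
    refine hf₁.image_of_equiv _ ?_ e.symm.toEquiv ?_
    · exact (measurePreserving_smul g⁻¹ volume).quasiMeasurePreserving
    · rintro σ τ
      obtain ⟨σ, rfl⟩ := e.surjective σ
      have h1 : e.symm.toEquiv (e σ) = σ := e.symm_apply_apply σ
      rw [h1]
      change toMoeb g • σ.1 • τ = (toMoeb g * σ.1 * (toMoeb g)⁻¹) • toMoeb g • τ
      simp only [← mul_smul, inv_mul_cancel_right]
  have himg : (MulAction.toPerm g : Equiv.Perm ℍ) '' fdOf Γ₁ = (fun τ : ℍ ↦ g • τ) '' fdOf Γ₁ := rfl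
  have hsub : (moeb Γ₁).map c.toMonoidHom ≤ moeb Γ₂ := by
    rintro _ ⟨σ, hσ, rfl⟩
    obtain ⟨γ, hγ, rfl⟩ := mem_moeb.1 hσ
    obtain ⟨δ, hδ, hδ'⟩ := hg γ hγ
    exact mem_moeb.2 ⟨δ, hδ, by simp [hδ', c]⟩
  have htop : volume ((fun τ : ℍ ↦ g • τ) '' fdOf Γ₁) < ⊤ := by
    have := measure_smul (μ := (volume : Measure ℍ)) g (fdOf Γ₁)
    exact this.trans_lt (volume_fdOf_lt_top Γ₁)
  rw [← hf₂.setAverage_eq_of_injective volume_ne_zero_upperHalfPlane hf₃ (Subgroup.inclusion hsub)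
    (Subgroup.inclusion_injective hsub) (fun _ _ ↦ rfl) (himg ▸ htop.ne) (f := h) ?_ ?_]
  · rw [setAverage_eq, setAverage_eq, himg, hmp.setIntegral_image_emb hemb]
    congr 2
    exact (congrArg ENNReal.toReal (measure_smul (μ := (volume : Measure ℍ)) g (fdOf Γ₁))).symm
  · rintro ⟨σ, hσ⟩ τ
    obtain ⟨γ, hγ, rfl⟩ := mem_moeb.1 hσ
    exact hinv γ hγ τ
  · exact Measure.integrableOn_of_bounded (M := C) (himg ▸ htop.ne) hcont.aestronglyMeasurable
      (.of_forall hbdd)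

/-! ### The Petersson inner product -/

theorem neg_one_mem_Gamma0 (ℓ : ℕ) : (-1 : SL(2, ℤ)) ∈ Gamma0 ℓ := by
  simp [Gamma0_mem]

theorem petersson_smul_Gamma0 {k ℓ : ℕ} (f g : A k ℓ) {γ : SL(2, ℤ)} (hγ : γ ∈ Gamma0 ℓ) (τ : ℍ) :
    petersson (k : ℤ) f g (γ • τ) = petersson k f g τ :=
  SlashInvariantFormClass.petersson_smul (Subgroup.mem_map_of_mem (mapGL ℝ) hγ)

theorem continuous_petersson {k ℓ : ℕ} (f g : A k ℓ) : Continuous (petersson (k : ℤ) f g) :=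
  petersson_continuous _ (ModularFormClass.continuous f) (ModularFormClass.continuous g)

theorem exists_norm_petersson_le {k ℓ : ℕ} [NeZero ℓ] (f g : A k ℓ) :
    ∃ C, ∀ τ, ‖petersson (k : ℤ) f g τ‖ ≤ C :=
  CuspFormClass.petersson_bounded_left k ((Gamma0 ℓ).map (mapGL ℝ)) f g

theorem volume_fundDomain_lt_top (ℓ : ℕ) [NeZero ℓ] : volume (fundDomain ℓ) < ⊤ :=
  volume_fdOf_lt_top (Gamma0 ℓ)

theorem volume_fundDomain_ne_zero (ℓ : ℕ) : volume (fundDomain ℓ) ≠ 0 :=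
  (isFundamentalDomain_fdOf (neg_one_mem_Gamma0 ℓ)).measure_ne_zero volume_ne_zero_upperHalfPlane

theorem integrableOn_petersson {k ℓ : ℕ} [NeZero ℓ] (f g : A k ℓ) :
    IntegrableOn (petersson (k : ℤ) f g) (fundDomain ℓ) := by
  obtain ⟨C, hC⟩ := exists_norm_petersson_le f g
  exact Measure.integrableOn_of_bounded (M := C) (volume_fundDomain_lt_top ℓ).ne
    (continuous_petersson f g).aestronglyMeasurable (.of_forall hC)

theorem inner_conj_symm {k ℓ : ℕ} (V : ℝ) (f g : A k ℓ) : conj (inner V g f) = inner V f g := by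
  simp only [inner, setAverage_eq, map_mul, Complex.conj_ofReal, Complex.real_smul,
    ← integral_conj, ← petersson_symm]

theorem inner_add_left {k ℓ : ℕ} [NeZero ℓ] (V : ℝ) (f g h : A k ℓ) :
    inner V (f + g) h = inner V f h + inner V g h := by
  have : petersson (k : ℤ) ⇑(f + g) h = fun τ ↦ petersson k f h τ + petersson k g h τ := by
    ext τ
    simp only [petersson, FunLike.coe_add, Pi.add_apply, map_add]
    ring
  simp only [inner, setAverage_eq, this,
    integral_add (integrableOn_petersson f h) (integrableOn_petersson g h), smul_add, mul_add]

theorem inner_smul_left {k ℓ : ℕ} (V : ℝ) (f g : A k ℓ) (c : ℂ) :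
    inner V (c • f) g = conj c * inner V f g := by
  have : petersson (k : ℤ) ⇑(c • f) g = fun τ ↦ conj c * petersson k f g τ := by
    ext τ
    simp only [petersson, FunLike.coe_smul, Pi.smul_apply, smul_eq_mul, map_mul]
    ring
  simp only [inner, setAverage_eq, this, integral_const_mul, Complex.real_smul]
  ring

theorem petersson_self {k : ℕ} (f : ℍ → ℂ) (τ : ℍ) :
    petersson (k : ℤ) f f τ = ((‖f τ‖ ^ 2 * τ.im ^ k : ℝ) : ℂ) := by
  simp [petersson, Complex.conj_mul']

theorem inner_self {k ℓ : ℕ} (V : ℝ) (f : A k ℓ) :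
    inner V f f = ((V * ((volume.real (fundDomain ℓ))⁻¹ *
      ∫ τ in fundDomain ℓ, ‖f τ‖ ^ 2 * τ.im ^ k) : ℝ) : ℂ) := by
  simp only [inner, setAverage_eq, petersson_self, integral_complex_ofReal, Complex.real_smul]
  push_cast
  rfl

/-- The set where `petersson k f f` is nonzero is open and invariant. It meets the fundamental
domain in a null set, so it is null, hence empty. -/
theorem eq_zero_of_inner_self_eq_zero {k ℓ : ℕ} [NeZero ℓ] {V : ℝ} (hV : 0 < V) {f : A k ℓ}
    (h : inner V f f = 0) : f = 0 := by
  have hvol : volume.real (fundDomain ℓ) ≠ 0 :=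
    ENNReal.toReal_ne_zero.2 ⟨volume_fundDomain_ne_zero ℓ, (volume_fundDomain_lt_top ℓ).ne⟩
  rw [inner_self, Complex.ofReal_eq_zero, mul_eq_zero, mul_eq_zero, or_iff_right hV.ne',
    inv_eq_zero, or_iff_right hvol] at h
  have hintg : IntegrableOn (fun τ : ℍ ↦ ‖f τ‖ ^ 2 * τ.im ^ k) (fundDomain ℓ) := by
    have := (integrableOn_petersson f f).re
    simp only [petersson_self, RCLike.re_eq_complex_re, Complex.ofReal_re] at this
    exact this
  rw [integral_eq_zero_iff_of_nonneg (fun τ ↦ mul_nonneg (sq_nonneg _) (pow_nonneg τ.im_pos.le _))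
    hintg] at h
  have hfd := isFundamentalDomain_fdOf (neg_one_mem_Gamma0 ℓ)
  set t : Set ℍ := {τ | petersson (k : ℤ) f f τ ≠ 0} with ht
  have hopen : IsOpen t := isOpen_ne_fun (continuous_petersson f f) continuous_const
  have hinv : ∀ σ : moeb (Gamma0 ℓ), (σ • · : ℍ → ℍ) ⁻¹' t = t := by
    rintro ⟨σ, hσ⟩
    obtain ⟨γ, hγ, rfl⟩ := mem_moeb.1 hσ
    ext τ
    change petersson (k : ℤ) f f (γ • τ) ≠ 0 ↔ _
    rw [petersson_smul_Gamma0 f f hγ]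
    rfl
  have hzero : volume t = 0 := by
    refine hfd.measure_zero_of_invariant t (fun σ ↦ ?_) ?_
    · rw [← Set.preimage_smul_inv, hinv]
    · rw [← Measure.restrict_apply₀' hfd.nullMeasurableSet, measure_eq_zero_iff_ae_notMem]
      filter_upwards [h] with τ hτ hmem
      exact hmem (by rw [petersson_self]; exact_mod_cast hτ)
  have hempty := (hopen.measure_eq_zero_iff volume).1 hzero
  ext τ
  by_contra hne
  have : τ ∈ t := by
    rw [ht, Set.mem_ofPred_eq, petersson_self]
    have h1 : 0 < ‖f τ‖ := norm_pos_iff.2 hne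
    have h2 := τ.im_pos
    exact_mod_cast (by positivity : ‖f τ‖ ^ 2 * τ.im ^ k ≠ 0)
  rw [hempty] at this
  exact this

/-- The Petersson inner product as a definite inner product. -/
abbrev innerCore {V : ℝ} (hV : 0 < V) (k ℓ : ℕ) [NeZero ℓ] : InnerProductSpace.Core ℂ (A k ℓ) where
  inner := inner V
  conj_inner_symm f g := inner_conj_symm V f g
  re_inner_nonneg f := by
    rw [inner_self, RCLike.re_eq_complex_re, Complex.ofReal_re]
    have : 0 ≤ ∫ τ in fundDomain ℓ, ‖f τ‖ ^ 2 * τ.im ^ k :=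
      integral_nonneg fun τ ↦ mul_nonneg (sq_nonneg _) (pow_nonneg τ.im_pos.le _)
    positivity
  add_left := inner_add_left V
  smul_left := inner_smul_left V
  definite _ := eq_zero_of_inner_self_eq_zero hV

/-! ### Finite dimensionality by a Sturm bound -/

section FiniteDimension

open Filter Topology Asymptotics Function

/-- Turns vanishing of coefficients into a growth condition, which can be multiplied over the
factors of a norm. -/
theorem natCast_le_analyticOrderAt_iff_isBigO {F : ℂ → ℂ} (hF : AnalyticAt ℂ F 0) (N : ℕ) :
    (N : ℕ∞) ≤ analyticOrderAt F 0 ↔ F =O[𝓝[≠] 0] fun z ↦ z ^ N := by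
  constructor
  · intro h
    obtain ⟨g, hg, hFg⟩ := (natCast_le_analyticOrderAt hF).1 h
    have h1 : F =ᶠ[𝓝[≠] 0] fun z ↦ z ^ N * g z := by
      filter_upwards [hFg.filter_mono nhdsWithin_le_nhds] with z hz
      simpa using hz
    refine h1.trans_isBigO ?_
    have h2 : g =O[𝓝[≠] 0] (fun _ ↦ (1 : ℂ)) :=
      (hg.continuousAt.isBigO_one ℂ).mono nhdsWithin_le_nhds
    simpa using (isBigO_refl (fun z : ℂ ↦ z ^ N) (𝓝[≠] 0)).mul h2
  · intro h
    by_contra! hlt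
    obtain ⟨n, hn⟩ := ENat.ne_top_iff_exists.1 hlt.ne_top
    rw [← hn, Nat.cast_lt] at hlt
    obtain ⟨g, hg, hg0, hFg⟩ := hF.analyticOrderAt_eq_natCast.1 hn.symm
    have h1 : g =O[𝓝[≠] 0] fun z ↦ z ^ (N - n) := by
      refine IsBigO.of_bound' ?_ |>.trans ?_ (g := fun z ↦ F z * (z ^ n)⁻¹)
      · filter_upwards [hFg.filter_mono nhdsWithin_le_nhds, self_mem_nhdsWithin] with z hz hz0
        have : z ^ n ≠ 0 := pow_ne_zero _ hz0
        rw [hz, sub_zero, smul_eq_mul, mul_comm, inv_mul_cancel_left₀ this]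
      · refine (h.mul (isBigO_refl (fun z ↦ (z ^ n)⁻¹) _)).trans (IsBigO.of_bound' ?_)
        filter_upwards [self_mem_nhdsWithin] with z hz0
        have : z ^ n ≠ 0 := pow_ne_zero _ hz0
        conv_lhs => rw [← Nat.sub_add_cancel hlt.le, pow_add, mul_inv_cancel_right₀ this]
    have h2 : Tendsto g (𝓝[≠] 0) (𝓝 0) := by
      refine h1.trans_tendsto ?_
      have : Tendsto (fun z : ℂ ↦ z ^ (N - n)) (𝓝 0) (𝓝 (0 ^ (N - n))) :=
        (continuous_pow _).tendsto 0
      rw [zero_pow (by omega)] at this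
      exact this.mono_left nhdsWithin_le_nhds
    exact hg0 (tendsto_nhds_unique (hg.continuousAt.tendsto.mono_left nhdsWithin_le_nhds) h2)

/-- A modular form of period `1` has a `q`-expansion starting in degree `N` if and only if it
decays like `q ^ N` at infinity. -/
theorem qExpansion_coeff_eq_zero_iff_isBigO {F : Type*} [FunLike F ℍ ℂ] {k : ℤ}
    {Γ : Subgroup (GL (Fin 2) ℝ)} [ModularFormClass F Γ k] (hΓ : 1 ∈ Γ.strictPeriods) (f : F)
    (N : ℕ) : (∀ i < N, (qExpansion 1 f).coeff i = 0) ↔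
      f =O[atImInfty] fun τ : ℍ ↦ (Periodic.qParam 1 τ) ^ N := by
  have han := ModularFormClass.analyticAt_cuspFunction_zero f one_pos hΓ
  have h1 : (∀ i < N, (qExpansion 1 f).coeff i = 0) ↔
      ∀ i < N, iteratedDeriv i (cuspFunction 1 f) 0 = 0 := by
    simp [qExpansion_coeff, Nat.factorial_ne_zero]
  rw [h1, ← natCast_le_analyticOrderAt_iff_iteratedDeriv_eq_zero han,
    natCast_le_analyticOrderAt_iff_isBigO han]
  constructor
  · intro h
    refine (h.comp_tendsto (tendsto_nhdsWithin_iff.2 ⟨qParam_tendsto_atImInfty one_pos,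
      .of_forall fun τ ↦ Periodic.qParam_ne_zero _⟩)).congr_left fun τ ↦ ?_
    exact SlashInvariantFormClass.eq_cuspFunction f τ hΓ one_ne_zero
  · intro h
    have h2 := h.comp_tendsto (tendsto_comap_im_ofComplex.comp (Periodic.invQParam_tendsto one_pos))
    refine h2.congr' ?_ ?_
    · filter_upwards [self_mem_nhdsWithin] with q hq
      exact (Periodic.cuspFunction_eq_of_nonzero 1 (f ∘ ofComplex) hq).symm
    · have h3 : ∀ᶠ q in 𝓝[≠] (0 : ℂ), 0 < (Periodic.invQParam 1 q).im :=
        (Periodic.invQParam_tendsto one_pos).eventually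
          (tendsto_comap.eventually (eventually_gt_atTop 0))
      filter_upwards [self_mem_nhdsWithin, h3] with q hq hq'
      simp only [comp_apply]
      rw [ofComplex_apply_of_im_pos hq', UpperHalfPlane.coe_mk,
        Periodic.qParam_right_inv one_ne_zero hq]

theorem one_mem_strictPeriods_Gamma0 (ℓ : ℕ) :
    1 ∈ ((Gamma0 ℓ).map (mapGL ℝ)).strictPeriods := by
  rw [strictPeriods_Gamma0]
  exact AddSubgroup.mem_zmultiples 1

/-- A cusp form on `Γ₀(ℓ)` with sufficiently many vanishing coefficients is zero. -/
theorem exists_forall_coeff_eq_zero_imp (k ℓ : ℕ) [NeZero ℓ] :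
    ∃ N : ℕ, ∀ f : A k ℓ, (∀ i < N, (qExpansion 1 f).coeff i = 0) → f = 0 := by
  set 𝒢 := (Gamma0 ℓ).map (mapGL ℝ)
  -- The weight of the norm of `f` to level one; a form of that weight vanishing to order greater
  -- than `w / 12` is zero.
  set w : ℤ := (k : ℤ) * Nat.card (𝒮ℒ ⧸ 𝒢.subgroupOf 𝒮ℒ)
  refine ⟨w.toNat / 12 + 1, fun f hf ↦ ?_⟩
  rw [qExpansion_coeff_eq_zero_iff_isBigO (one_mem_strictPeriods_Gamma0 ℓ)] at hf
  have hnorm : ModularForm.norm 𝒮ℒ f = 0 := by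
    apply ModularForm.sturm_bound_levelOne
    refine lt_of_lt_of_le (b := ((w.toNat / 12 + 1 : ℕ) : ℕ∞)) (Nat.cast_lt.2 (Nat.lt_succ_self _)) ?_
    apply PowerSeries.nat_le_order
    rw [qExpansion_coeff_eq_zero_iff_isBigO one_mem_strictPeriods_SL]
    rw [ModularForm.coe_norm]
    let := Fintype.ofFinite (𝒮ℒ ⧸ 𝒢.subgroupOf 𝒮ℒ)
    classical
    -- All conjugates of `f` are bounded at infinity, so the decay of the factor `f` at the identity
    -- coset passes to the whole norm.
    have hbdd : ∀ r : 𝒮ℒ ⧸ 𝒢.subgroupOf 𝒮ℒ,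
        SlashInvariantForm.quotientFunc f r =O[atImInfty] fun _ ↦ (1 : ℂ) := by
      refine Quotient.forall.2 fun ⟨r, hr⟩ ↦ ?_
      obtain ⟨γ, hγ⟩ := inv_mem hr
      rw [SlashInvariantForm.quotientFunc_mk]
      simp only [← hγ]
      exact (ModularFormClass.bdd_at_infty_slash f γ).trans
        (isBigO_of_le _ fun _ ↦ by simp)
    have hone : SlashInvariantForm.quotientFunc f (⟦1⟧ : 𝒮ℒ ⧸ 𝒢.subgroupOf 𝒮ℒ) = f := by
      rw [SlashInvariantForm.quotientFunc_mk]
      simp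
    have hprod := Finset.mul_prod_erase Finset.univ
      (fun r : 𝒮ℒ ⧸ 𝒢.subgroupOf 𝒮ℒ ↦ SlashInvariantForm.quotientFunc f r) (Finset.mem_univ ⟦1⟧)
    rw [hone] at hprod
    refine IsBigO.congr_left ?_ (fun τ ↦ congrFun hprod τ)
    have := hf.mul (IsBigO.finsetProd
      (s := Finset.univ.erase (⟦(1 : 𝒮ℒ)⟧ : 𝒮ℒ ⧸ 𝒢.subgroupOf 𝒮ℒ)) fun r _ ↦ hbdd r)
    simp only [Finset.prod_const_one, mul_one] at this
    simp only [Finset.prod_fn, Pi.mul_def]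
    exact this
  have := (ModularForm.norm_eq_zero_iff 𝒮ℒ f).1 hnorm
  ext τ
  exact congrFun this τ

instance finiteDimensional (k ℓ : ℕ) [NeZero ℓ] : FiniteDimensional ℂ (A k ℓ) := by
  obtain ⟨N, hN⟩ := exists_forall_coeff_eq_zero_imp k ℓ
  let c : A k ℓ →ₗ[ℂ] (Fin N → ℂ) :=
    { toFun f i := (qExpansion 1 f).coeff i
      map_add' f g := by
        ext i
        simp only [FunLike.coe_add, Pi.add_apply]
        rw [ModularForm.qExpansion_add one_pos (one_mem_strictPeriods_Gamma0 ℓ) f g, map_add]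
      map_smul' a f := by
        ext i
        simp only [FunLike.coe_smul, Pi.smul_apply, RingHom.id_apply]
        rw [ModularForm.qExpansion_smul one_pos (one_mem_strictPeriods_Gamma0 ℓ) a f]
        simp }
  refine FiniteDimensional.of_injective c ((injective_iff_map_eq_zero c).2 fun f hf ↦ ?_)
  exact hN f fun i hi ↦ congrFun hf ⟨i, hi⟩

end FiniteDimension

/-! ### Level raising and conjugation by `diag(d, 1)` -/

open Matrix.GeneralLinearGroup (upperRightHom)
open scoped ModularForm

theorem mem_Gamma0_iff_dvd {N : ℕ} {γ : SL(2, ℤ)} : γ ∈ Gamma0 N ↔ (N : ℤ) ∣ γ 1 0 := by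
  rw [Gamma0_mem, ZMod.intCast_zmod_eq_zero_iff_dvd]

theorem Gamma0_le_of_dvd {M N : ℕ} (h : M ∣ N) : Gamma0 N ≤ Gamma0 M := fun _ hγ ↦
  mem_Gamma0_iff_dvd.2 ((Int.natCast_dvd_natCast.2 h).trans (mem_Gamma0_iff_dvd.1 hγ))

/-- The matrix `diag(d, 1)`. -/
def diag (d : ℕ) [NeZero d] : GL (Fin 2) ℝ :=
  .mkOfDetNeZero !![(d : ℝ), 0; 0, 1] (by simp [NeZero.ne d])

/-- The lower triangular unipotent matrix with entry `x`. -/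
def lower (x : ℝ) : GL (Fin 2) ℝ := .mkOfDetNeZero !![1, 0; x, 1] (by simp)

/-- The integral lower triangular unipotent matrix with entry `n`. -/
def lowerSL (n : ℤ) : SL(2, ℤ) := ⟨!![1, 0; n, 1], by simp⟩

@[simp] theorem coe_diag (d : ℕ) [NeZero d] : (diag d).val = !![(d : ℝ), 0; 0, 1] := rfl

@[simp] theorem coe_lower (x : ℝ) : (lower x).val = !![1, 0; x, 1] := rfl

theorem mapGL_lowerSL (n : ℤ) : mapGL ℝ (lowerSL n) = lower n := by
  ext i j
  change ((!![1, 0; n, 1] i j : ℤ) : ℝ) = !![1, 0; (n : ℝ), 1] i j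
  fin_cases i <;> fin_cases j <;> simp

theorem mapGL_T_pow (n : ℕ) : mapGL ℝ (ModularGroup.T ^ n) = upperRightHom (n : ℝ) := by
  ext i j
  rw [← zpow_natCast]
  change (((ModularGroup.T ^ (n : ℤ)).1 i j : ℤ) : ℝ) = !![1, (n : ℝ); 0, 1] i j
  rw [ModularGroup.coe_T_zpow]
  fin_cases i <;> fin_cases j <;> simp

theorem diag_mul_upper (d : ℕ) [NeZero d] (x : ℝ) :
    diag d * upperRightHom x = upperRightHom (d * x) * diag d := by
  ext i j
  fin_cases i <;> fin_cases j <;> simp [Matrix.mul_apply, Fin.sum_univ_two]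

theorem diag_mul_lower (d : ℕ) [NeZero d] (x : ℝ) :
    diag d * lower (d * x) = lower x * diag d := by
  ext i j
  fin_cases i <;> fin_cases j <;> simp [Matrix.mul_apply, Fin.sum_univ_two, mul_comm]

theorem mapGL_mul_diag_eq_iff (d : ℕ) [NeZero d] (γ δ : SL(2, ℤ)) :
    mapGL ℝ γ * diag d = diag d * mapGL ℝ δ ↔
      γ 0 0 = δ 0 0 ∧ γ 0 1 = d * δ 0 1 ∧ δ 1 0 = d * γ 1 0 ∧ γ 1 1 = δ 1 1 := by
  have hd : (d : ℝ) ≠ 0 := NeZero.ne _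
  rw [Units.ext_iff, ← Matrix.ext_iff]
  simp only [Fin.forall_fin_two, Units.val_mul, coe_diag, Matrix.mul_apply, Fin.sum_univ_two,
    Matrix.SpecialLinearGroup.mapGL_coe_matrix, Matrix.SpecialLinearGroup.map_apply_coe,
    RingHom.mapMatrix_apply, Matrix.map_apply, algebraMap_int_eq, Int.coe_castRingHom,
    Matrix.of_apply, Matrix.cons_val', Matrix.cons_val_zero, Matrix.cons_val_one,
    Matrix.cons_val_fin_one, mul_zero, add_zero, zero_add, mul_one, zero_mul, one_mul]
  rw [mul_comm (d : ℝ), mul_left_inj' hd, mul_comm _ (d : ℝ)]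
  norm_cast
  constructor
  · rintro ⟨⟨h1, h2⟩, h3, h4⟩
    exact ⟨h1, h2, h3.symm, h4⟩
  · rintro ⟨h1, h2, h3, h4⟩
    exact ⟨⟨h1, h2⟩, h3.symm, h4⟩

theorem exists_sl_entries {a b c d : ℤ} (h : a * d - b * c = 1) :
    ∃ δ : SL(2, ℤ), δ 0 0 = a ∧ δ 0 1 = b ∧ δ 1 0 = c ∧ δ 1 1 = d :=
  ⟨⟨!![a, b; c, d], by rw [Matrix.det_fin_two_of, h]⟩, rfl, rfl, rfl, rfl⟩

/-- Conjugation by `diag(d, 1)` maps `Γ₀(dℓ)` to `Γ₀(ℓ)`. -/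
theorem exists_diag_conj (d ℓ : ℕ) [NeZero d] {γ : SL(2, ℤ)} (hγ : γ ∈ Gamma0 (d * ℓ)) :
    ∃ δ ∈ Gamma0 ℓ, mapGL ℝ δ = diag d * mapGL ℝ γ * (diag d)⁻¹ := by
  obtain ⟨c, hc⟩ := mem_Gamma0_iff_dvd.1 hγ
  have hdet := γ.det_coe
  rw [Matrix.det_fin_two] at hdet
  rw [hc] at hdet
  push_cast at hdet
  obtain ⟨δ, h1, h2, h3, h4⟩ := exists_sl_entries (a := γ 0 0) (b := d * γ 0 1) (c := ℓ * c)
    (d := γ 1 1) (by linear_combination hdet)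
  refine ⟨δ, mem_Gamma0_iff_dvd.2 ⟨c, h3⟩, ?_⟩
  rw [eq_mul_inv_iff_mul_eq, mapGL_mul_diag_eq_iff]
  refine ⟨h1, h2, ?_, h4⟩
  rw [hc, h3]
  push_cast
  exact mul_assoc _ _ _

/-- Makes the coset conditions for the upper trace explicit congruences on matrix entries. -/
theorem mapGL_mem_conj_diag_iff (d ℓ : ℕ) [NeZero d] (γ : SL(2, ℤ)) :
    mapGL ℝ γ ∈ ConjAct.toConjAct (diag d) • (Gamma0 (d * ℓ)).map (mapGL ℝ) ↔
      γ ∈ Gamma0 ℓ ∧ (d : ℤ) ∣ γ 0 1 := by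
  have hd : (d : ℤ) ≠ 0 := NeZero.ne _
  rw [Subgroup.mem_pointwise_smul_iff_inv_smul_mem, ← map_inv, ConjAct.toConjAct_smul,
    inv_inv, Subgroup.mem_map]
  simp only [mem_Gamma0_iff_dvd]
  constructor
  · rintro ⟨δ, hδ, h⟩
    rw [mul_assoc, eq_inv_mul_iff_mul_eq, eq_comm, mapGL_mul_diag_eq_iff] at h
    obtain ⟨-, h2, h3, -⟩ := h
    refine ⟨?_, _, h2⟩
    rw [h3] at hδ
    push_cast at hδ
    exact (mul_dvd_mul_iff_left hd).1 hδ
  · rintro ⟨h1, b, hb⟩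
    have hdet := γ.det_coe
    rw [Matrix.det_fin_two, hb] at hdet
    obtain ⟨δ, e1, e2, e3, e4⟩ := exists_sl_entries (a := γ 0 0) (b := b) (c := d * γ 1 0)
      (d := γ 1 1) (by linear_combination hdet)
    refine ⟨δ, ?_, ?_⟩
    · rw [e3]
      push_cast
      exact mul_dvd_mul_left _ h1
    · rw [mul_assoc, eq_inv_mul_iff_mul_eq, eq_comm, mapGL_mul_diag_eq_iff, e1, e2, e3, e4]
      exact ⟨rfl, hb, rfl, rfl⟩

theorem coe_diag_smul (d : ℕ) [NeZero d] (τ : ℍ) : ((diag d • τ : ℍ) : ℂ) = d * τ := by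
  have hd : 0 < (d : ℝ) := by exact_mod_cast NeZero.pos d
  rw [coe_smul_of_det_pos (by simpa using hd)]
  simp [num, denom]

theorem ofComplex_mul (d : ℕ) [NeZero d] (τ : ℍ) : ofComplex ((d : ℂ) * τ) = diag d • τ := by
  rw [← coe_diag_smul, ofComplex_apply]

theorem slash_diag_apply (d : ℕ) [NeZero d] (k : ℕ) (f : ℍ → ℂ) (τ : ℍ) :
    (f ∣[(k : ℤ)] diag d) τ = (d : ℂ) ^ ((k : ℤ) - 1) * f (diag d • τ) := by
  have hd : 0 < (d : ℝ) := by exact_mod_cast NeZero.pos d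
  rw [ModularForm.slash_apply]
  simp [σ, denom, hd, mul_comm]

theorem raise_apply {k ℓ : ℕ} (d : ℕ) [NeZero d] (φ : A k ℓ) (τ : ℍ) :
    raise d φ τ = (((d : ℝ) ^ ((k : ℝ) / 2) : ℝ) : ℂ) * φ (diag d • τ) := by
  rw [raise, ofComplex_mul]

/-- The scalar relating `φ|_d` to the slash action of `diag(d, 1)`. -/
def raiseConst (k d : ℕ) : ℂ := (((d : ℝ) ^ (1 - (k : ℝ) / 2) : ℝ) : ℂ)

theorem raise_eq_slash {k ℓ : ℕ} (d : ℕ) [NeZero d] (φ : A k ℓ) :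
    raise d φ = raiseConst k d • (⇑φ ∣[(k : ℤ)] diag d) := by
  have hd : 0 < (d : ℝ) := by exact_mod_cast NeZero.pos d
  ext τ
  rw [raise_apply, Pi.smul_apply, slash_diag_apply, smul_eq_mul, ← mul_assoc, raiseConst]
  congr 1
  have : (d : ℝ) ^ ((k : ℝ) / 2) = (d : ℝ) ^ (1 - (k : ℝ) / 2) * (d : ℝ) ^ ((k : ℤ) - 1) := by
    rw [← Real.rpow_intCast, ← Real.rpow_add hd]
    congr 1
    push_cast
    ring
  rw [this]
  push_cast
  rfl

theorem raiseConst_ne_zero (k d : ℕ) [NeZero d] : raiseConst k d ≠ 0 := by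
  have hd : 0 < (d : ℝ) := by exact_mod_cast NeZero.pos d
  rw [raiseConst, Complex.ofReal_ne_zero]
  positivity

/-- Restriction of a cusp form to a smaller group. -/
def restrict {Γ Γ' : Subgroup (GL (Fin 2) ℝ)} {k : ℤ} (h : Γ' ≤ Γ) (f : CuspForm Γ k) :
    CuspForm Γ' k where
  toFun := f
  slash_action_eq' γ hγ := f.slash_action_eq' γ (h hγ)
  holo' := f.holo'
  zero_at_cusps' hc := f.zero_at_cusps' (hc.mono h)

theorem Gamma0_le_conj_diag {d ℓ q : ℕ} [NeZero d] (h : d * ℓ ∣ q) :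
    (Gamma0 q).map (mapGL ℝ) ≤
      ConjAct.toConjAct (diag d)⁻¹ • (Gamma0 ℓ).map (mapGL ℝ) := by
  rintro _ ⟨γ, hγ, rfl⟩
  obtain ⟨δ, hδ, hδ'⟩ := exists_diag_conj d ℓ (Gamma0_le_of_dvd h hγ)
  rw [Subgroup.mem_pointwise_smul_iff_inv_smul_mem, ← map_inv, inv_inv, ConjAct.toConjAct_smul,
    ← hδ']
  exact ⟨δ, hδ, rfl⟩

/-- The map `φ ↦ φ|_d` from level `ℓ` to level `q`, for `dℓ ∣ q`. -/
def raiseLin {k d ℓ q : ℕ} [NeZero d] (h : d * ℓ ∣ q) : A k ℓ →ₗ[ℂ] A k q where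
  toFun φ := raiseConst k d • restrict (Gamma0_le_conj_diag h) (CuspForm.translate φ (diag d))
  map_add' φ ψ := by
    ext τ
    change raiseConst k d * (⇑(φ + ψ) ∣[(k : ℤ)] diag d) τ = raiseConst k d * _ + raiseConst k d * _
    rw [FunLike.coe_add, SlashAction.add_slash, Pi.add_apply, mul_add]
    rfl
  map_smul' c φ := by
    ext τ
    change raiseConst k d * (⇑(c • φ) ∣[(k : ℤ)] diag d) τ = c * (raiseConst k d * _)
    rw [FunLike.coe_smul, slash_diag_apply, Pi.smul_apply, smul_eq_mul]
    change _ = c * (raiseConst k d * (⇑φ ∣[(k : ℤ)] diag d) τ)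
    rw [slash_diag_apply]
    ring

@[simp] theorem coe_raiseLin {k d ℓ q : ℕ} [NeZero d] (h : d * ℓ ∣ q) (φ : A k ℓ) :
    ⇑(raiseLin h φ) = raise d φ := by
  rw [raise_eq_slash]
  rfl

/-- The two factors `d ^ (k / 2)` are exactly what turns `τ.im ^ k` into `(d τ.im) ^ k`. -/
theorem petersson_raise {k ℓ : ℕ} (d : ℕ) [NeZero d] (φ ψ : A k ℓ) (τ : ℍ) :
    petersson (k : ℤ) (raise d φ) (raise d ψ) τ = petersson k φ ψ (diag d • τ) := by
  have hd : 0 < (d : ℝ) := by exact_mod_cast NeZero.pos d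
  have him : (diag d • τ).im = d * τ.im := by
    rw [← coe_im, coe_diag_smul]
    simp
  have hsq : (((d : ℝ) ^ ((k : ℝ) / 2) : ℝ) : ℂ) * (((d : ℝ) ^ ((k : ℝ) / 2) : ℝ) : ℂ)
      = (d : ℂ) ^ k := by
    rw [← Complex.ofReal_mul, ← Real.rpow_add hd, add_halves, Real.rpow_natCast]
    push_cast
    rfl
  simp only [petersson, raise_apply, him, map_mul, Complex.conj_ofReal, zpow_natCast]
  push_cast
  rw [mul_pow, ← hsq]
  ring

/-- Raising the level is an isometry for the normalised Petersson inner products. -/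
theorem inner_raiseLin {k d ℓ q : ℕ} [NeZero d] [NeZero ℓ] [NeZero q] (h : d * ℓ ∣ q) (V : ℝ)
    (φ ψ : A k ℓ) : inner V (raiseLin h φ) (raiseLin h ψ) = inner V φ ψ := by
  obtain ⟨C, hC⟩ := exists_norm_petersson_le φ ψ
  have := setAverage_fdOf_smul (neg_one_mem_Gamma0 q) (neg_one_mem_Gamma0 ℓ) (diag d)
    (fun γ hγ ↦ exists_diag_conj d ℓ (Gamma0_le_of_dvd h hγ))
    (fun γ hγ τ ↦ petersson_smul_Gamma0 φ ψ hγ τ) (continuous_petersson φ ψ) hC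
  simp only [inner, coe_raiseLin, fundDomain_eq_fdOf, petersson_raise]
  rw [this]

/-! ### Lowering the level by a prime: traces as averages over unipotents -/

theorem slash_smul' (k : ℕ) (g : GL (Fin 2) ℝ) (hg : 0 < g.det.val) (c : ℂ) (f : ℍ → ℂ) :
    (c • f) ∣[(k : ℤ)] g = c • (f ∣[(k : ℤ)] g) := by
  rw [ModularForm.smul_slash]
  simp only [σ]
  rw [if_pos hg]
  rfl

/-- The trace of a cusp form as a sum over explicit coset representatives. -/
theorem coe_trace_eq_sum {𝒢 ℋ : Subgroup (GL (Fin 2) ℝ)} {k : ℤ} [𝒢.IsFiniteRelIndex ℋ]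
    (f : CuspForm 𝒢 k) {ι : Type*} [Fintype ι] (r : ι → GL (Fin 2) ℝ) (hr : ∀ i, r i ∈ ℋ)
    (hinj : ∀ i j, r i * (r j)⁻¹ ∈ 𝒢 → i = j) (hsurj : ∀ h ∈ ℋ, ∃ i, r i * h ∈ 𝒢) :
    ⇑(CuspForm.trace ℋ f) = ∑ i, ⇑f ∣[k] r i := by
  rw [CuspForm.coe_trace]
  let := Fintype.ofFinite (ℋ ⧸ 𝒢.subgroupOf ℋ)
  let F : ι → ℋ ⧸ 𝒢.subgroupOf ℋ := fun i ↦ ((⟨r i, hr i⟩⁻¹ : ℋ) : ℋ ⧸ 𝒢.subgroupOf ℋ)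
  have hF : Function.Bijective F := by
    constructor
    · intro i j hij
      have := QuotientGroup.eq.1 hij
      rw [Subgroup.mem_subgroupOf] at this
      exact hinj i j (by simpa using this)
    · refine Quotient.forall.2 fun ⟨h, hh⟩ ↦ ?_
      obtain ⟨i, hi⟩ := hsurj h hh
      refine ⟨i, QuotientGroup.eq.2 ?_⟩
      rw [Subgroup.mem_subgroupOf]
      simpa using hi
  refine (hF.sum_comp (fun c ↦ SlashInvariantForm.quotientFunc f c)).symm.trans ?_
  refine Finset.sum_congr rfl fun i _ ↦ ?_
  have := SlashInvariantForm.quotientFunc_mk (f := f) (⟨r i, hr i⟩⁻¹ : ℋ)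
  refine this.trans ?_
  simp

/-- `diag(d, 1)` over the rationals. -/
def diagRat (d : ℕ) [NeZero d] : GL (Fin 2) ℚ :=
  .mkOfDetNeZero !![(d : ℚ), 0; 0, 1] (by simp [NeZero.ne d])

theorem map_diagRat (d : ℕ) [NeZero d] : (diagRat d).map (Rat.castHom ℝ) = diag d := by
  ext i j
  change ((!![(d : ℚ), 0; 0, 1] i j : ℚ) : ℝ) = !![(d : ℝ), 0; 0, 1] i j
  fin_cases i <;> fin_cases j <;> simp

theorem map_upperRightHom (x : ℚ) :
    (upperRightHom x).map (Rat.castHom ℝ) = upperRightHom (x : ℝ) := by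
  ext i j
  change ((!![1, x; 0, 1] i j : ℚ) : ℝ) = !![1, (x : ℝ); 0, 1] i j
  fin_cases i <;> fin_cases j <;> simp

theorem map_mapGL_rat (γ : SL(2, ℤ)) : (mapGL ℚ γ).map (Rat.castHom ℝ) = mapGL ℝ γ := by
  ext i j
  change (((γ i j : ℤ) : ℚ) : ℝ) = ((γ i j : ℤ) : ℝ)
  simp

theorem isFiniteRelIndex_of_isArithmetic (𝒢 ℋ : Subgroup (GL (Fin 2) ℝ)) [h𝒢 : 𝒢.IsArithmetic]
    [hℋ : ℋ.IsArithmetic] : 𝒢.IsFiniteRelIndex ℋ :=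
  ⟨(h𝒢.is_commensurable.trans hℋ.is_commensurable.symm).1⟩

/-- The diagonal entries become units mod `p`, so `p` unipotents suffice to represent all cosets. -/
theorem not_prime_dvd_entries {p : ℕ} (hp : p.Prime) {γ : SL(2, ℤ)} (h : (p : ℤ) ∣ γ 1 0) :
    ((γ 0 0 : ℤ) : ZMod p) ≠ 0 ∧ ((γ 1 1 : ℤ) : ZMod p) ≠ 0 := by
  have := Fact.mk hp
  have hdet := γ.det_coe
  rw [Matrix.det_fin_two] at hdet
  have h1 := congrArg (Int.cast : ℤ → ZMod p) hdet
  rw [← ZMod.intCast_zmod_eq_zero_iff_dvd] at h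
  push_cast at h1
  rw [h, mul_zero, sub_zero] at h1
  exact ⟨left_ne_zero_of_mul_eq_one h1, right_ne_zero_of_mul_eq_one h1⟩

theorem T_pow_mul_apply (n : ℕ) (γ : SL(2, ℤ)) :
    (ModularGroup.T ^ n * γ) 0 1 = γ 0 1 + n * γ 1 1 ∧
      (ModularGroup.T ^ n * γ) 1 0 = γ 1 0 := by
  rw [← zpow_natCast, Matrix.SpecialLinearGroup.coe_mul, ModularGroup.coe_T_zpow]
  simp [Matrix.mul_apply, Fin.sum_univ_two]

theorem lowerSL_mul_apply (n : ℤ) (γ : SL(2, ℤ)) :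
    (lowerSL n * γ) 1 0 = n * γ 0 0 + γ 1 0 := by
  rw [Matrix.SpecialLinearGroup.coe_mul, lowerSL]
  simp [Matrix.mul_apply, Fin.sum_univ_two]

theorem lowerSL_inv (n : ℤ) : (lowerSL n)⁻¹ = lowerSL (-n) := by
  rw [inv_eq_iff_mul_eq_one]
  ext i j
  rw [Matrix.SpecialLinearGroup.coe_mul, lowerSL, lowerSL]
  fin_cases i <;> fin_cases j <;> simp [Matrix.mul_apply, Fin.sum_univ_two]

theorem zmod_eq_of_dvd_val_sub {p : ℕ} [NeZero p] {a b : ZMod p}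
    (h : (p : ℤ) ∣ (a.val : ℤ) - b.val) : a = b := by
  rw [← ZMod.intCast_zmod_eq_zero_iff_dvd] at h
  push_cast at h
  rw [ZMod.natCast_zmod_val, ZMod.natCast_zmod_val] at h
  exact sub_eq_zero.1 h

/-- The average of a form of level `pℓ` over translations by multiples of `1 / p` is raised from
level `ℓ`, if `p ∣ ℓ`. -/
theorem exists_raise_eq_average_upper {k p ℓ M : ℕ} [hp : Fact p.Prime] [NeZero ℓ]
    (hM : M = p * ℓ) (hpl : p ∣ ℓ) (φ : A k M) :
    ∃ ψ : A k ℓ, raise p ψ =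
      (p : ℂ)⁻¹ • ∑ b : ZMod p, ⇑φ ∣[(k : ℤ)] upperRightHom ((b.val : ℝ) / p) := by
  subst hM
  have hp0 : (p : ℝ) ≠ 0 := NeZero.ne _
  have hne : NeZero (p * ℓ) := ⟨mul_ne_zero (NeZero.ne p) (NeZero.ne ℓ)⟩
  set 𝒢 := ConjAct.toConjAct ((diag p)⁻¹)⁻¹ • (Gamma0 (p * ℓ)).map (mapGL ℝ) with h𝒢
  have h𝒢' : 𝒢 = ConjAct.toConjAct (diag p) • (Gamma0 (p * ℓ)).map (mapGL ℝ) := by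
    rw [h𝒢, inv_inv]
  have har : 𝒢.IsArithmetic := by
    rw [h𝒢', ← map_diagRat]
    exact Subgroup.IsArithmetic.conj _ _
  have hfin : 𝒢.IsFiniteRelIndex ((Gamma0 ℓ).map (mapGL ℝ)) :=
    isFiniteRelIndex_of_isArithmetic _ _
  have key := coe_trace_eq_sum (ℋ := (Gamma0 ℓ).map (mapGL ℝ)) (CuspForm.translate φ (diag p)⁻¹)
    (fun b : ZMod p ↦ mapGL ℝ (ModularGroup.T ^ b.val)) ?_ ?_ ?_
  -- The factor `p⁻¹` makes the trace an average; the other undoes the normalisation built into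
  -- `raise`.
  · refine ⟨((p : ℂ)⁻¹ * (raiseConst k p)⁻¹) •
      CuspForm.trace ((Gamma0 ℓ).map (mapGL ℝ)) (CuspForm.translate φ (diag p)⁻¹), ?_⟩
    rw [raise_eq_slash, FunLike.coe_smul, slash_smul' _ _ (by simpa using NeZero.pos p), smul_smul,
      mul_left_comm, mul_inv_cancel₀ (raiseConst_ne_zero k p), mul_one]
    congr 1
    rw [key, SlashAction.sum_slash]
    refine Finset.sum_congr rfl fun b _ ↦ ?_
    change ((⇑φ ∣[(k : ℤ)] (diag p)⁻¹) ∣[(k : ℤ)] _) ∣[(k : ℤ)] _ = _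
    rw [← SlashAction.slash_mul, ← SlashAction.slash_mul, mapGL_T_pow]
    congr 1
    rw [inv_mul_eq_iff_eq_mul, diag_mul_upper, mul_div_cancel₀ _ hp0]
  · intro b
    refine Subgroup.mem_map_of_mem _ ?_
    rw [mem_Gamma0_iff_dvd, ← mul_one (ModularGroup.T ^ b.val), (T_pow_mul_apply _ _).2]
    simp
  · intro a b h
    rw [← map_inv, ← map_mul, ← h𝒢, h𝒢', mapGL_mem_conj_diag_iff] at h
    have h2 : ModularGroup.T ^ a.val * (ModularGroup.T ^ b.val)⁻¹ =
        ModularGroup.T ^ ((a.val : ℤ) - b.val) := by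
      rw [zpow_sub, zpow_natCast, zpow_natCast]
    rw [h2, ModularGroup.coe_T_zpow] at h
    exact zmod_eq_of_dvd_val_sub (by simpa using h.2)
  · rintro _ ⟨γ, hγ, rfl⟩
    have hγ' := mem_Gamma0_iff_dvd.1 hγ
    obtain ⟨-, h11⟩ := not_prime_dvd_entries hp.out
      ((Int.natCast_dvd_natCast.2 hpl).trans hγ')
    -- Solves `γ 0 1 + b * γ 1 1 ≡ 0` mod `p`, the upper right entry of `T ^ b * γ`.
    refine ⟨-(γ 0 1 : ZMod p) / (γ 1 1 : ZMod p), ?_⟩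
    rw [← map_mul, ← h𝒢, h𝒢', mapGL_mem_conj_diag_iff, mem_Gamma0_iff_dvd, (T_pow_mul_apply _ _).2,
      (T_pow_mul_apply _ _).1, ← ZMod.intCast_zmod_eq_zero_iff_dvd _ p]
    refine ⟨hγ', ?_⟩
    push_cast
    rw [ZMod.natCast_zmod_val, div_mul_cancel₀ _ h11, add_neg_cancel]

/-- The average of a form of level `pℓ` over lower triangular unipotents has level `ℓ`,
if `p ∣ ℓ`. -/
theorem exists_eq_average_lower {k p ℓ M : ℕ} [hp : Fact p.Prime] [NeZero ℓ]
    (hM : M = p * ℓ) (hpl : p ∣ ℓ) (φ : A k M) :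
    ∃ ψ : A k ℓ, ⇑ψ = (p : ℂ)⁻¹ • ∑ b : ZMod p, ⇑φ ∣[(k : ℤ)] lower ((b.val : ℝ) * ℓ) := by
  subst hM
  have hℓ0 : (ℓ : ℤ) ≠ 0 := NeZero.ne _
  have hne : NeZero (p * ℓ) := ⟨mul_ne_zero (NeZero.ne p) (NeZero.ne ℓ)⟩
  have hfin : ((Gamma0 (p * ℓ)).map (mapGL ℝ)).IsFiniteRelIndex ((Gamma0 ℓ).map (mapGL ℝ)) :=
    isFiniteRelIndex_of_isArithmetic _ _
  have hmem : ∀ {γ : SL(2, ℤ)} {N : ℕ}, mapGL ℝ γ ∈ (Gamma0 N).map (mapGL ℝ) ↔ γ ∈ Gamma0 N :=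
    fun {γ N} ↦ Subgroup.mem_map_iff_mem Matrix.SpecialLinearGroup.mapGL_injective
  have key := coe_trace_eq_sum (ℋ := (Gamma0 ℓ).map (mapGL ℝ)) φ
    (fun b : ZMod p ↦ mapGL ℝ (lowerSL (b.val * ℓ))) ?_ ?_ ?_
  · refine ⟨(p : ℂ)⁻¹ • CuspForm.trace ((Gamma0 ℓ).map (mapGL ℝ)) φ, ?_⟩
    rw [FunLike.coe_smul, key]
    congr 1
    refine Finset.sum_congr rfl fun b _ ↦ ?_
    rw [mapGL_lowerSL]
    push_cast
    rfl
  · intro b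
    rw [hmem, mem_Gamma0_iff_dvd]
    exact dvd_mul_left (ℓ : ℤ) b.val
  · intro a b h
    rw [← map_inv, ← map_mul, hmem, mem_Gamma0_iff_dvd, lowerSL_mul_apply, lowerSL_inv] at h
    have h' : (p : ℤ) * ℓ ∣ (a.val - b.val) * ℓ := by
      simpa [lowerSL, add_mul, sub_eq_add_neg] using h
    exact zmod_eq_of_dvd_val_sub ((mul_dvd_mul_iff_right hℓ0).1 h')
  · rintro _ ⟨γ, hγ, rfl⟩
    obtain ⟨c, hc⟩ := mem_Gamma0_iff_dvd.1 hγ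
    obtain ⟨h00, -⟩ := not_prime_dvd_entries hp.out
      ((Int.natCast_dvd_natCast.2 hpl).trans (mem_Gamma0_iff_dvd.1 hγ))
    obtain ⟨x, y, hxy⟩ : ∃ x : ZMod p, (p : ℤ) ∣ x.val * γ 0 0 + c := by
      -- With `γ 1 0 = ℓ * c`, the lower left entry of the product is `ℓ * (x * γ 0 0 + c)`, which
      -- must be divisible by `p * ℓ`.
      refine ⟨-(c : ZMod p) / (γ 0 0 : ZMod p), ?_⟩
      rw [← ZMod.intCast_zmod_eq_zero_iff_dvd _ p]
      push_cast
      rw [ZMod.natCast_zmod_val, div_mul_cancel₀ _ h00, neg_add_cancel]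
    refine ⟨x, ?_⟩
    rw [← map_mul, hmem, mem_Gamma0_iff_dvd, lowerSL_mul_apply, hc]
    refine ⟨y, ?_⟩
    push_cast
    linear_combination (ℓ : ℤ) * hxy

/-! ### Averaging does not change inner products with invariant forms -/

/-- The average of `f` over rational unimodular matrices fixing `w` has the same inner product
with `w` as `f`. -/
theorem inner_eq_of_average {k q : ℕ} [NeZero q] (V : ℝ) {ι : Type*} [Fintype ι] [Nonempty ι]
    (g : ι → GL (Fin 2) ℚ) (hdet : ∀ i, ((g i).map (Rat.castHom ℝ)).det.val = 1) (w f u : A k q)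
    (hw : ∀ i, ⇑w ∣[(k : ℤ)] (g i).map (Rat.castHom ℝ) = w)
    (hu : ⇑u = (Fintype.card ι : ℂ)⁻¹ • ∑ i, ⇑f ∣[(k : ℤ)] (g i).map (Rat.castHom ℝ)) :
    inner V w u = inner V w f := by
  set G : ι → GL (Fin 2) ℝ := fun i ↦ (g i).map (Rat.castHom ℝ)
  -- One group under which all the translated integrands are invariant. It has finite index because
  -- the matrices are rational.
  set Γ : Subgroup SL(2, ℤ) := (⨅ i, conjGL (Gamma0 q) (G i)) ⊓ Gamma0 q with hΓ
  have hfi : ∀ i, (conjGL (Gamma0 q) (G i)).FiniteIndex := fun i ↦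
    ((Gamma0_is_congruence q).conjGL (g i)).finiteIndex
  have : Γ.FiniteIndex := by
    have := Subgroup.finiteIndex_iInf hfi
    infer_instance
  have hneg : -1 ∈ Γ := by
    refine ⟨Subgroup.mem_iInf.2 fun i ↦ mem_conjGL.2 ⟨-1, neg_one_mem_Gamma0 q, ?_⟩,
      neg_one_mem_Gamma0 q⟩
    have : ((-1 : SL(2, ℤ)) : GL (Fin 2) ℝ) = -1 := by
      ext i j
      simp
    rw [this]
    simp
  obtain ⟨C, hC⟩ := exists_norm_petersson_le w f
  obtain ⟨C', hC'⟩ := exists_norm_petersson_le w u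
  have h1 : ∀ i, ⨍ τ in fdOf Γ, petersson (k : ℤ) w f (G i • τ) =
      ⨍ τ in fdOf (Gamma0 q), petersson (k : ℤ) w f τ := fun i ↦
    setAverage_fdOf_smul hneg (neg_one_mem_Gamma0 q) (G i)
      (fun γ hγ ↦ mem_conjGL.1 (Subgroup.mem_iInf.1 hγ.1 i))
      (fun γ hγ τ ↦ petersson_smul_Gamma0 w f hγ τ) (continuous_petersson w f) hC
  have h2 : ⨍ τ in fdOf Γ, petersson (k : ℤ) w u τ =
      ⨍ τ in fdOf (Gamma0 q), petersson (k : ℤ) w u τ := by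
    have := setAverage_fdOf_smul hneg (neg_one_mem_Gamma0 q) 1 (fun γ hγ ↦ ⟨γ, hγ.2, by simp⟩)
      (fun γ hγ τ ↦ petersson_smul_Gamma0 w u hγ τ) (continuous_petersson w u) hC'
    simpa using this
  have h3 : ∀ τ, petersson (k : ℤ) w u τ =
      (Fintype.card ι : ℂ)⁻¹ * ∑ i, petersson (k : ℤ) w f (G i • τ) := by
    intro τ
    -- Slashing both arguments by `G i` translates the Petersson product, and slashing does not
    -- change `w`.
    have h4 : ∀ i, petersson (k : ℤ) w f (G i • τ) =
        conj (w τ) * (⇑f ∣[(k : ℤ)] G i) τ * τ.im ^ (k : ℤ) := by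
      intro i
      have := petersson_slash k w f (G i) τ
      rw [hw i, hdet i] at this
      have hσ : σ (G i) = ContinuousAlgEquiv.refl ℝ ℂ := by
        rw [σ, if_pos (by rw [hdet i]; exact one_pos)]
      rw [hσ] at this
      simpa [petersson] using this.symm
    rw [Finset.sum_congr rfl fun i _ ↦ h4 i, ← Finset.sum_mul, ← Finset.mul_sum]
    simp only [petersson, hu, Pi.smul_apply, Finset.sum_apply, smul_eq_mul]
    ring
  have hcard : (Fintype.card ι : ℂ) ≠ 0 := by simp [Fintype.card_ne_zero]
  have hintg : ∀ i, Integrable (fun τ ↦ petersson (k : ℤ) w f (G i • τ))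
      (volume.restrict (fdOf Γ)) := fun i ↦
    Measure.integrableOn_of_bounded (M := C) (volume_fdOf_lt_top Γ).ne
      ((continuous_petersson w f).comp (continuous_const_smul (G i))).aestronglyMeasurable
      (.of_forall fun τ ↦ hC _)
  have h5 : ⨍ τ in fdOf Γ, petersson (k : ℤ) w u τ =
      (Fintype.card ι : ℂ)⁻¹ * ∑ i, ⨍ τ in fdOf Γ, petersson (k : ℤ) w f (G i • τ) := by
    simp only [setAverage_eq, h3, integral_const_mul, integral_finsetSum _ fun i _ ↦ hintg i,
      Complex.real_smul, ← Finset.mul_sum]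
    ring
  simp only [inner, fundDomain_eq_fdOf]
  rw [← h2, h5, Finset.sum_congr rfl fun i _ ↦ h1 i, Finset.sum_const, Finset.card_univ,
    nsmul_eq_mul, inv_mul_cancel_left₀ hcard]

/-! ### Raised spaces and the action of the averages on them -/

/-- The forms `φ|_d` of level `q`, with `φ` of level `ℓ`, as a submodule. -/
def raisedSubmodule (k q ℓ d : ℕ) : Submodule ℂ (A k q) where
  carrier := raised k q ℓ d
  add_mem' := by
    rintro f g ⟨φ, hφ⟩ ⟨ψ, hψ⟩
    refine ⟨φ + ψ, ?_⟩
    ext τ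
    simp only [FunLike.coe_add, hφ, hψ, raise, Pi.add_apply]
    ring
  zero_mem' := ⟨0, by ext τ; simp [raise]⟩
  smul_mem' := by
    rintro c f ⟨φ, hφ⟩
    refine ⟨c • φ, ?_⟩
    ext τ
    simp only [FunLike.coe_smul, hφ, raise, Pi.smul_apply, smul_eq_mul]
    ring

@[simp] theorem coe_raisedSubmodule (k q ℓ d : ℕ) :
    (raisedSubmodule k q ℓ d : Set (A k q)) = raised k q ℓ d := rfl

@[simp] theorem mem_raisedSubmodule {k q ℓ d : ℕ} {f : A k q} :
    f ∈ raisedSubmodule k q ℓ d ↔ f ∈ raised k q ℓ d := Iff.rfl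

theorem raise_mul {k ℓ : ℕ} (c d : ℕ) [NeZero c] [NeZero d] (φ : A k ℓ) (τ : ℍ) :
    raise (c * d) φ τ = (((c : ℝ) ^ ((k : ℝ) / 2) : ℝ) : ℂ) * raise d φ (diag c • τ) := by
  have : NeZero (c * d) := ⟨mul_ne_zero (NeZero.ne c) (NeZero.ne d)⟩
  rw [raise_apply, raise_apply, ← mul_assoc, ← Complex.ofReal_mul,
    ← Real.mul_rpow (by positivity) (by positivity)]
  have hd : diag (c * d) • τ = diag d • diag c • τ := by
    ext
    simp only [coe_diag_smul]
    push_cast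
    ring
  rw [hd]
  push_cast
  rfl

theorem raise_mul_eq_slash {k ℓ : ℕ} (c d : ℕ) [NeZero c] [NeZero d] (φ : A k ℓ) :
    raise (c * d) φ = raiseConst k c • (raise d φ ∣[(k : ℤ)] diag c) := by
  have h : d * ℓ ∣ d * ℓ := dvd_rfl
  have := raise_eq_slash c (raiseLin h φ)
  rw [coe_raiseLin] at this
  rw [← this]
  ext τ
  rw [raise_mul, raise_apply c (raiseLin h φ), coe_raiseLin]

theorem raise_one {k ℓ : ℕ} (φ : A k ℓ) : raise 1 φ = φ := by
  ext τ
  simp [raise]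

/-- `φ|_{cd} = (φ|_d)|_c` lies in the space raised by `c`. -/
theorem raised_mul_subset {k q ℓ c d m : ℕ} [NeZero c] [NeZero d] (h : d * ℓ ∣ m) :
    raised k q ℓ (c * d) ⊆ raised k q m c := by
  rintro f ⟨φ, hφ⟩
  refine ⟨raiseLin h φ, ?_⟩
  ext τ
  rw [hφ, raise_mul, raise_apply c (raiseLin h φ), coe_raiseLin]

theorem raised_subset {k q d d' e e' : ℕ} [NeZero q] (hd : d ∣ d') (he : e ∣ e')
    (h : d' * e' ∣ q) : raised k q (q / (d' * e')) d' ⊆ raised k q (q / (d * e)) d := by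
  obtain ⟨c, rfl⟩ := hd
  obtain ⟨a, rfl⟩ := he
  obtain ⟨ℓ, hℓ⟩ := h
  have hq : d * c * (e * a) * ℓ ≠ 0 := hℓ ▸ NeZero.ne q
  simp only [mul_ne_zero_iff] at hq
  obtain ⟨⟨⟨hd, hc⟩, he, ha⟩, -⟩ := hq
  have : NeZero d := ⟨hd⟩
  have : NeZero c := ⟨hc⟩
  apply raised_mul_subset
  have h1 : q / (d * c * (e * a)) = ℓ := by
    rw [hℓ]; exact Nat.mul_div_cancel_left _ (by positivity)
  have h2 : q / (d * e) = c * a * ℓ := by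
    rw [hℓ, show d * c * (e * a) * ℓ = (d * e) * (c * a * ℓ) by ring]
    exact Nat.mul_div_cancel_left _ (by positivity)
  rw [h1, h2]
  exact ⟨a, by ring⟩

/-- Moving a unipotent past `diag(d, 1)` rescales its entry; the factor prime to `p` that results
only permutes the residues. -/
theorem sum_zmod_mul_eq {E : Type*} [AddCommMonoid E] {p : ℕ} [hp : Fact p.Prime] {d : ℕ}
    (hd : ¬ p ∣ d) (F : ℤ → E) (hF : ∀ n m : ℤ, F (n + p * m) = F n) :
    ∑ b : ZMod p, F (d * b.val) = ∑ b : ZMod p, F b.val := by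
  have hd0 : (d : ZMod p) ≠ 0 := by rwa [Ne, ZMod.natCast_eq_zero_iff]
  refine Fintype.sum_equiv (Equiv.mulLeft₀ (d : ZMod p) hd0) _ _ fun b ↦ ?_
  have h : ((((Equiv.mulLeft₀ (d : ZMod p) hd0) b).val : ℤ) : ZMod p) = ((d * b.val : ℤ) : ZMod p) := by
    simp
  obtain ⟨m, hm⟩ := (ZMod.intCast_eq_intCast_iff_dvd_sub _ _ p).1 h
  rw [← hF (((Equiv.mulLeft₀ (d : ZMod p) hd0) b).val : ℤ) m, ← hm]
  congr 1
  ring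

theorem slash_upper_intCast {k M : ℕ} (φ : A k M) (n : ℤ) :
    ⇑φ ∣[(k : ℤ)] upperRightHom (n : ℝ) = φ := by
  refine SlashInvariantFormClass.slash_action_eq φ _ ?_
  rw [← Subgroup.mem_strictPeriods_iff, strictPeriods_Gamma0]
  exact ⟨n, by simp⟩

theorem slash_lower_intCast {k M : ℕ} (φ : A k M) {n : ℤ} (hn : (M : ℤ) ∣ n) :
    ⇑φ ∣[(k : ℤ)] lower (n : ℝ) = φ := by
  refine SlashInvariantFormClass.slash_action_eq φ _ ?_
  rw [← mapGL_lowerSL]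
  exact Subgroup.mem_map_of_mem _ (mem_Gamma0_iff_dvd.2 hn)

theorem lower_add (x y : ℝ) : lower (x + y) = lower x * lower y := by
  ext i j
  fin_cases i <;> fin_cases j <;> simp [Matrix.mul_apply, Fin.sum_univ_two]

theorem raise_slash_upper {k ℓ : ℕ} (d : ℕ) [NeZero d] (φ : A k ℓ) (x : ℝ) :
    raise d φ ∣[(k : ℤ)] upperRightHom x =
      raiseConst k d • ((⇑φ ∣[(k : ℤ)] upperRightHom (d * x)) ∣[(k : ℤ)] diag d) := by
  rw [raise_eq_slash, slash_smul' _ _ (by simp), ← SlashAction.slash_mul, diag_mul_upper,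
    SlashAction.slash_mul]

theorem raise_slash_lower {k ℓ : ℕ} (d : ℕ) [NeZero d] (φ : A k ℓ) (x : ℝ) :
    raise d φ ∣[(k : ℤ)] lower (d * x) =
      raiseConst k d • ((⇑φ ∣[(k : ℤ)] lower x) ∣[(k : ℤ)] diag d) := by
  rw [raise_eq_slash, slash_smul' _ _ (by simp), ← SlashAction.slash_mul, diag_mul_lower,
    SlashAction.slash_mul]

/-- The average of `f` over translations by multiples of `1 / p`. -/
def upperAvg (k p : ℕ) [NeZero p] (f : ℍ → ℂ) : ℍ → ℂ :=
  (p : ℂ)⁻¹ • ∑ b : ZMod p, f ∣[(k : ℤ)] upperRightHom ((b.val : ℝ) / p)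

/-- The average of `f` over the lower unipotents with entries the multiples of `r`. -/
def lowerAvg (k p r : ℕ) [NeZero p] (f : ℍ → ℂ) : ℍ → ℂ :=
  (p : ℂ)⁻¹ • ∑ b : ZMod p, f ∣[(k : ℤ)] lower ((b.val : ℝ) * r)

/-- Past `diag(d, 1)` the translation by `b / p` becomes one by the integer `d * b / p`. -/
theorem raised_slash_upper {k q ℓ d p b : ℕ} [NeZero d] [NeZero p] (hpd : p ∣ d) {f : A k q}
    (hf : f ∈ raised k q ℓ d) : ⇑f ∣[(k : ℤ)] upperRightHom ((b : ℝ) / p) = f := by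
  obtain ⟨φ, hφ⟩ := hf
  obtain ⟨c, rfl⟩ := hpd
  have hp : (p : ℝ) ≠ 0 := NeZero.ne _
  have h1 : ((p * c : ℕ) : ℝ) * (b / p) = ((c * b : ℤ) : ℝ) := by
    push_cast
    field_simp
  rw [hφ, raise_slash_upper, h1, slash_upper_intCast, ← raise_eq_slash]

theorem raised_slash_lower {k q ℓ d r b : ℕ} [NeZero d] (h : d * ℓ ∣ r) {f : A k q}
    (hf : f ∈ raised k q ℓ d) : ⇑f ∣[(k : ℤ)] lower ((b : ℝ) * r) = f := by
  obtain ⟨φ, hφ⟩ := hf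
  obtain ⟨c, rfl⟩ := h
  have h1 : (b : ℝ) * ((d * ℓ * c : ℕ) : ℝ) = d * ((ℓ * (c * b) : ℤ) : ℝ) := by
    push_cast
    ring
  rw [hφ, h1, raise_slash_lower, slash_lower_intCast φ (dvd_mul_right _ _), ← raise_eq_slash]

/-- On `φ|_d` the average becomes, up to reordering, the same average of `φ`, which is `ψ|_p` with
`ψ` of level `ℓ`. -/
theorem exists_upperAvg_of_not_dvd {k p d e ℓ q : ℕ} [hp : Fact p.Prime] [NeZero q]
    (hq : q = d * e * (p * ℓ)) (hpl : p ∣ ℓ) (hpd : ¬ p ∣ d) {f : A k q}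
    (hf : f ∈ raised k q (p * ℓ) d) :
    ∃ u ∈ raised k q ℓ (d * p), ⇑u = upperAvg k p f := by
  have hq0 : d * e * (p * ℓ) ≠ 0 := hq ▸ NeZero.ne q
  simp only [mul_ne_zero_iff] at hq0
  obtain ⟨⟨hd, he⟩, -, hℓ⟩ := hq0
  have : NeZero d := ⟨hd⟩
  have : NeZero ℓ := ⟨hℓ⟩
  have : NeZero (d * p) := ⟨mul_ne_zero hd (NeZero.ne p)⟩
  obtain ⟨φ, hφ⟩ := hf
  obtain ⟨ψ, hψ⟩ := exists_raise_eq_average_upper rfl hpl φ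
  have hdvd : d * p * ℓ ∣ q := ⟨e, by rw [hq]; ring⟩
  refine ⟨raiseLin hdvd ψ, ⟨ψ, coe_raiseLin _ _⟩, ?_⟩
  have hp0 : (p : ℝ) ≠ 0 := NeZero.ne _
  have hsum := sum_zmod_mul_eq hpd (fun n ↦ ⇑φ ∣[(k : ℤ)] upperRightHom ((n : ℝ) / p)) ?_
  · rw [coe_raiseLin, raise_mul_eq_slash, hψ, slash_smul' _ _ (by simpa using NeZero.pos d),
      upperAvg, hφ, smul_comm, Finset.sum_congr rfl fun b _ ↦ raise_slash_upper d φ _,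
      ← Finset.smul_sum, ← SlashAction.sum_slash]
    congr 3
    push_cast at hsum
    rw [← hsum]
    exact Finset.sum_congr rfl fun b _ ↦ by rw [mul_div_assoc]
  · intro n m
    have : (((n + p * m : ℤ)) : ℝ) / p = (m : ℝ) + n / p := by
      push_cast
      field_simp
      ring
    rw [this, AddChar.map_add_eq_mul, SlashAction.slash_mul, slash_upper_intCast]

/-- Here `q / p = d * (e * ℓ)`: the factor `d` is absorbed by `diag(d, 1)`, and `e`, prime to `p`,
permutes the residues. What remains is the trace of `φ` to level `ℓ`. -/
theorem exists_lowerAvg_of_not_dvd {k p d e ℓ q : ℕ} [hp : Fact p.Prime] [NeZero q]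
    (hq : q = d * e * (p * ℓ)) (hpl : p ∣ ℓ) (hpe : ¬ p ∣ e) {f : A k q}
    (hf : f ∈ raised k q (p * ℓ) d) :
    ∃ u ∈ raised k q ℓ d, ⇑u = lowerAvg k p (q / p) f := by
  have hq0 : d * e * (p * ℓ) ≠ 0 := hq ▸ NeZero.ne q
  simp only [mul_ne_zero_iff] at hq0
  obtain ⟨⟨hd, he⟩, -, hℓ⟩ := hq0
  have : NeZero d := ⟨hd⟩
  have : NeZero ℓ := ⟨hℓ⟩
  obtain ⟨φ, hφ⟩ := hf
  obtain ⟨ψ, hψ⟩ := exists_eq_average_lower rfl hpl φ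
  have hdvd : d * ℓ ∣ q := ⟨e * p, by rw [hq]; ring⟩
  refine ⟨raiseLin hdvd ψ, ⟨ψ, coe_raiseLin _ _⟩, ?_⟩
  have hqp : q / p = d * (e * ℓ) := by
    rw [hq, show d * e * (p * ℓ) = p * (d * (e * ℓ)) by ring,
      Nat.mul_div_cancel_left _ hp.out.pos]
  have hsum := sum_zmod_mul_eq hpe (fun n ↦ ⇑φ ∣[(k : ℤ)] lower ((n : ℝ) * ℓ)) ?_
  · have hterm : ∀ b : ZMod p, raise d φ ∣[(k : ℤ)] lower ((b.val : ℝ) * (q / p : ℕ)) =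
        raiseConst k d • ((⇑φ ∣[(k : ℤ)] lower ((e : ℝ) * b.val * ℓ)) ∣[(k : ℤ)] diag d) := by
      intro b
      rw [← raise_slash_lower, hqp]
      congr 2
      push_cast
      ring
    rw [coe_raiseLin, raise_eq_slash, hψ, slash_smul' _ _ (by simpa using NeZero.pos d),
      lowerAvg, hφ, smul_comm, Finset.sum_congr rfl fun b _ ↦ hterm b,
      ← Finset.smul_sum, ← SlashAction.sum_slash]
    congr 3
    push_cast at hsum
    rw [← hsum]
  · intro n m
    have : (((n + p * m : ℤ)) : ℝ) * ℓ = ((((p * ℓ : ℕ) : ℤ) * m : ℤ) : ℝ) + n * ℓ := by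
      push_cast
      ring
    rw [this, lower_add, SlashAction.slash_mul, slash_lower_intCast φ (dvd_mul_right _ _)]

theorem inner_upperAvg {k p q ℓ d : ℕ} [NeZero p] [NeZero q] [NeZero d] (V : ℝ) (hpd : p ∣ d)
    {w f u : A k q} (hw : w ∈ raised k q ℓ d) (hu : ⇑u = upperAvg k p f) :
    inner V w u = inner V w f := by
  have hmap : ∀ b : ZMod p, (upperRightHom ((b.val : ℚ) / p)).map (Rat.castHom ℝ) =
      upperRightHom ((b.val : ℝ) / p) := by
    intro b
    rw [map_upperRightHom]
    push_cast
    rfl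
  refine inner_eq_of_average V (fun b : ZMod p ↦ upperRightHom ((b.val : ℚ) / p)) ?_ w f u ?_ ?_
  · intro b
    rw [hmap]
    simp
  · intro b
    rw [hmap]
    exact raised_slash_upper hpd hw
  · rw [hu, upperAvg, ZMod.card]
    simp only [hmap]

theorem inner_lowerAvg {k p q ℓ d r : ℕ} [NeZero p] [NeZero q] [NeZero d] (V : ℝ)
    (hr : d * ℓ ∣ r) {w f u : A k q} (hw : w ∈ raised k q ℓ d) (hu : ⇑u = lowerAvg k p r f) :
    inner V w u = inner V w f := by
  have hmap : ∀ b : ZMod p, (mapGL ℚ (lowerSL (b.val * r))).map (Rat.castHom ℝ) =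
      lower ((b.val : ℝ) * r) := by
    intro b
    rw [map_mapGL_rat, mapGL_lowerSL]
    push_cast
    rfl
  refine inner_eq_of_average V (fun b : ZMod p ↦ mapGL ℚ (lowerSL (b.val * r))) ?_ w f u ?_ ?_
  · intro b
    rw [hmap]
    simp
  · intro b
    rw [hmap]
    exact raised_slash_lower hr hw
  · rw [hu, lowerAvg, ZMod.card]
    simp only [hmap]

/-! ### Divisibility and Möbius cancellation -/

open ArithmeticFunction (moebius)

/-- Each squarefree factor contributes at most one power of a prime, and three are available. Two
factors carry the projector indices, the third keeps `p` in the level. -/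
theorem mul_mul_dvd_of_squarefree {q : ℕ} (hq : q ≠ 0)
    (hcube : ∀ p : ℕ, p.Prime → p ∣ q → p ^ 3 ∣ q) {a b c : ℕ} (ha : Squarefree a)
    (hb : Squarefree b) (hc : Squarefree c) (haq : a ∣ q) (hbq : b ∣ q) (hcq : c ∣ q) :
    a * b * c ∣ q := by
  rw [← Nat.factorization_le_iff_dvd
      (mul_ne_zero (mul_ne_zero ha.ne_zero hb.ne_zero) hc.ne_zero) hq,
    Nat.factorization_mul (mul_ne_zero ha.ne_zero hb.ne_zero) hc.ne_zero,
    Nat.factorization_mul ha.ne_zero hb.ne_zero]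
  intro p
  simp only [Finsupp.add_apply]
  have h1 := ha.natFactorization_le_one p
  have h2 := hb.natFactorization_le_one p
  have h3 := hc.natFactorization_le_one p
  by_cases hp : p.Prime
  · by_cases hpq : p ∣ q
    · have := (hp.pow_dvd_iff_le_factorization hq).1 (hcube p hp hpq)
      omega
    · rw [Nat.factorization_eq_zero_of_not_dvd fun h ↦ hpq (h.trans haq),
        Nat.factorization_eq_zero_of_not_dvd fun h ↦ hpq (h.trans hbq),
        Nat.factorization_eq_zero_of_not_dvd fun h ↦ hpq (h.trans hcq)]
      simp
  · simp [Nat.factorization_eq_zero_of_not_prime _ hp]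

/-- Cancellation in a Möbius sum against a function insensitive to a prime `p`. -/
theorem sum_moebius_mul_eq_zero {q p : ℕ} (hq : q ≠ 0) (hp : p.Prime) (hpq : p ∣ q) (G : ℕ → ℂ)
    (hG : ∀ d, d ∣ q → Squarefree d → ¬ p ∣ d → G (d * p) = G d) :
    ∑ d ∈ q.divisors, (moebius d : ℂ) * G d = 0 := by
  have hfilter : ∑ d ∈ q.divisors with Squarefree d, (moebius d : ℂ) * G d =
      ∑ d ∈ q.divisors, (moebius d : ℂ) * G d := by
    refine Finset.sum_filter_of_ne fun d _ hd ↦ ?_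
    by_contra h
    simp [ArithmeticFunction.moebius_eq_zero_of_not_squarefree h] at hd
  rw [← hfilter, ← Finset.sum_filter_not_add_sum_filter _ (p ∣ ·), ← eq_neg_iff_add_eq_zero,
    ← Finset.sum_neg_distrib]
  -- Squarefree divisors prime to `p` are matched with those divisible by `p`, and `μ (d * p) = -μ
  -- d`.
  refine Finset.sum_bij (fun d _ ↦ d * p) ?_ ?_ ?_ ?_
  · intro d hd
    simp only [Finset.mem_filter, Nat.mem_divisors] at hd ⊢
    obtain ⟨⟨⟨hdq, -⟩, hds⟩, hpd⟩ := hd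
    have hcop : d.Coprime p := ((hp.coprime_iff_not_dvd).2 hpd).symm
    exact ⟨⟨⟨hcop.mul_dvd_of_dvd_of_dvd hdq hpq, hq⟩,
      (Nat.squarefree_mul hcop).2 ⟨hds, hp.prime.squarefree⟩⟩, dvd_mul_left _ _⟩
  · intro a _ b _ h
    exact Nat.eq_of_mul_eq_mul_right hp.pos h
  · intro b hb
    simp only [Finset.mem_filter, Nat.mem_divisors] at hb
    obtain ⟨⟨⟨hbq, -⟩, hbs⟩, hpb⟩ := hb
    obtain ⟨c, rfl⟩ := hpb
    have hcop := Nat.coprime_of_squarefree_mul hbs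
    refine ⟨c, ?_, mul_comm _ _⟩
    simp only [Finset.mem_filter, Nat.mem_divisors]
    exact ⟨⟨⟨(dvd_mul_left _ _).trans hbq, hq⟩, hbs.of_mul_right⟩,
      (hp.coprime_iff_not_dvd).1 hcop⟩
  · intro d hd
    simp only [Finset.mem_filter, Nat.mem_divisors] at hd
    obtain ⟨⟨⟨hdq, -⟩, hds⟩, hpd⟩ := hd
    have hcop : d.Coprime p := ((hp.coprime_iff_not_dvd).2 hpd).symm
    rw [hG d hdq hds hpd, ArithmeticFunction.isMultiplicative_moebius.map_mul_of_coprime hcop,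
      ArithmeticFunction.moebius_apply_prime hp]
    push_cast
    ring

/-! ### Existence and uniqueness of orthogonal projectors -/

section Projector

variable {k ℓ : ℕ} [NeZero ℓ] {V : ℝ}

/-- The Petersson inner product as a linear form in its second variable. -/
def innerRight (V : ℝ) (w : A k ℓ) : A k ℓ →ₗ[ℂ] ℂ where
  toFun := inner V w
  map_add' f g := by
    rw [← inner_conj_symm, inner_add_left, map_add, inner_conj_symm, inner_conj_symm]
  map_smul' c f := by
    rw [← inner_conj_symm, inner_smul_left, map_mul, inner_conj_symm, Complex.conj_conj]
    rfl

theorem innerRight_apply (V : ℝ) (w f : A k ℓ) : innerRight V w f = inner V w f := rfl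

theorem inner_zero_left (V : ℝ) (f : A k ℓ) : inner V 0 f = 0 := by
  rw [← inner_conj_symm, ← innerRight_apply, map_zero, map_zero]

theorem inner_sub_right (V : ℝ) (w f g : A k ℓ) :
    inner V w (f - g) = inner V w f - inner V w g :=
  map_sub (innerRight V w) f g

theorem exists_isOrthogonalProjector (hV : 0 < V) (W : Submodule ℂ (A k ℓ)) :
    ∃ E : A k ℓ →ₗ[ℂ] A k ℓ, IsOrthogonalProjector V E (W : Set (A k ℓ)) := by
  let c := innerCore hV k ℓ
  let _ : NormedAddCommGroup (A k ℓ) := c.toNormedAddCommGroup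
  let _ : InnerProductSpace ℂ (A k ℓ) := InnerProductSpace.ofCore c.toCore
  refine ⟨(W.starProjection : A k ℓ →ₗ[ℂ] A k ℓ), fun f ↦
    ⟨W.starProjection_apply_mem f, fun w hw ↦ ?_⟩⟩
  exact W.inner_right_of_mem_orthogonal hw (W.sub_starProjection_mem_orthogonal f)

theorem IsOrthogonalProjector.inner_apply {E : A k ℓ →ₗ[ℂ] A k ℓ} {W : Set (A k ℓ)}
    (hE : IsOrthogonalProjector V E W) {w : A k ℓ} (hw : w ∈ W) (f : A k ℓ) :
    inner V w (E f) = inner V w f := by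
  have := (hE f).2 w hw
  rw [inner_sub_right, sub_eq_zero] at this
  exact this.symm

/-- Uniqueness of the projection: `E f - u` lies in `W` and is orthogonal to `W`, hence to itself.
-/
theorem IsOrthogonalProjector.apply_eq (hV : 0 < V) {E : A k ℓ →ₗ[ℂ] A k ℓ}
    {W : Submodule ℂ (A k ℓ)} (hE : IsOrthogonalProjector V E (W : Set (A k ℓ))) {f u : A k ℓ}
    (hu : u ∈ W) (h : ∀ w ∈ W, inner V w u = inner V w f) : E f = u := by
  rw [← sub_eq_zero]
  have hmem : E f - u ∈ W := W.sub_mem (hE f).1 hu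
  refine eq_zero_of_inner_self_eq_zero hV ?_
  rw [inner_sub_right, hE.inner_apply hmem, h _ hmem, sub_self]

end Projector

/-! ### The projector onto the newspace -/

section Newspace

variable {k q : ℕ} [NeZero q] {V : ℝ}

/-- `E' f` is the upper average of `E f`, and forms raised by `p` do not see that average. -/
theorem IsOrthogonalProjector.inner_apply_mul_left (hV : 0 < V)
    (hcube : ∀ p : ℕ, p.Prime → p ∣ q → p ^ 3 ∣ q) {p d e : ℕ} (hp : p.Prime) (hpq : p ∣ q)
    (hdq : d ∣ q) (heq : e ∣ q) (hd : Squarefree d) (he : Squarefree e) (hpd : ¬ p ∣ d)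
    {E E' : A k q →ₗ[ℂ] A k q} (hE : IsOrthogonalProjector V E (raised k q (q / (d * e)) d))
    (hE' : IsOrthogonalProjector V E' (raised k q (q / (d * p * e)) (d * p))) {w : A k q}
    (hw : w ∈ raised k q (q / p) p) (f : A k q) : inner V w (E' f) = inner V w (E f) := by
  have : Fact p.Prime := ⟨hp⟩
  have hcop : d.Coprime p := ((hp.coprime_iff_not_dvd).2 hpd).symm
  have hdp : Squarefree (d * p) := (Nat.squarefree_mul hcop).2 ⟨hd, hp.prime.squarefree⟩
  obtain ⟨m, hm⟩ := mul_mul_dvd_of_squarefree (NeZero.ne q) hcube hdp he hp.prime.squarefree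
    (hcop.mul_dvd_of_dvd_of_dvd hdq hpq) heq hpq
  have : NeZero (d * p) := ⟨hdp.ne_zero⟩
  have hde : 0 < d * e := Nat.mul_pos hd.ne_zero.bot_lt he.ne_zero.bot_lt
  have h1 : q / (d * e) = p * (p * m) := by
    rw [hm, show d * p * e * p * m = d * e * (p * (p * m)) by ring]
    exact Nat.mul_div_cancel_left _ hde
  have h2 : q / (d * p * e) = p * m := by
    rw [hm, show d * p * e * p * m = d * p * e * (p * m) by ring]
    exact Nat.mul_div_cancel_left _ (by rw [mul_right_comm]; exact Nat.mul_pos hde hp.pos)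
  have hsub : raised k q (q / (d * p * e)) (d * p) ⊆ raised k q (q / (d * e)) d :=
    raised_subset (dvd_mul_right _ _) dvd_rfl ⟨p * m, by rw [hm]; ring⟩
  obtain ⟨u, hu, hu'⟩ := exists_upperAvg_of_not_dvd (e := e) (by rw [hm]; ring)
    (dvd_mul_right p m) hpd (h1 ▸ (hE f).1)
  rw [← h2] at hu
  -- The smaller raised space lies in the larger and is fixed by the translations, so on it `u`, `E
  -- f` and `f` have equal inner products.
  have : E' f = u := IsOrthogonalProjector.apply_eq hV
    (W := raisedSubmodule k q (q / (d * p * e)) (d * p)) hE' hu fun w hw ↦ by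
      rw [inner_upperAvg V (dvd_mul_left p d) hw hu', hE.inner_apply (hsub hw)]
  rw [this, inner_upperAvg V dvd_rfl hw hu']

/-- `E' f` is the average of `E f` over lower unipotents with entries multiples of `q / p`, which
fix every form of level `q / p`. -/
theorem IsOrthogonalProjector.inner_apply_mul_right (hV : 0 < V)
    (hcube : ∀ p : ℕ, p.Prime → p ∣ q → p ^ 3 ∣ q) {p d e : ℕ} (hp : p.Prime) (hpq : p ∣ q)
    (hdq : d ∣ q) (heq : e ∣ q) (hd : Squarefree d) (he : Squarefree e) (hpe : ¬ p ∣ e)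
    {E E' : A k q →ₗ[ℂ] A k q} (hE : IsOrthogonalProjector V E (raised k q (q / (d * e)) d))
    (hE' : IsOrthogonalProjector V E' (raised k q (q / (d * (e * p))) d)) {w : A k q}
    (hw : w ∈ raised k q (q / p) 1) (f : A k q) : inner V w (E' f) = inner V w (E f) := by
  have : Fact p.Prime := ⟨hp⟩
  have hcop : e.Coprime p := ((hp.coprime_iff_not_dvd).2 hpe).symm
  have hep : Squarefree (e * p) := (Nat.squarefree_mul hcop).2 ⟨he, hp.prime.squarefree⟩
  obtain ⟨m, hm⟩ := mul_mul_dvd_of_squarefree (NeZero.ne q) hcube hd hep hp.prime.squarefree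
    hdq (hcop.mul_dvd_of_dvd_of_dvd heq hpq) hpq
  have : NeZero d := ⟨hd.ne_zero⟩
  have hde : 0 < d * e := Nat.mul_pos hd.ne_zero.bot_lt he.ne_zero.bot_lt
  have h1 : q / (d * e) = p * (p * m) := by
    rw [hm, show d * (e * p) * p * m = d * e * (p * (p * m)) by ring]
    exact Nat.mul_div_cancel_left _ hde
  have h2 : q / (d * (e * p)) = p * m := by
    rw [hm, show d * (e * p) * p * m = d * (e * p) * (p * m) by ring]
    exact Nat.mul_div_cancel_left _ (by rw [← mul_assoc]; exact Nat.mul_pos hde hp.pos)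
  have h3 : q / p = d * (p * m) * e := by
    rw [hm, show d * (e * p) * p * m = p * (d * (p * m) * e) by ring]
    exact Nat.mul_div_cancel_left _ hp.pos
  have hsub : raised k q (q / (d * (e * p))) d ⊆ raised k q (q / (d * e)) d :=
    raised_subset dvd_rfl (dvd_mul_right _ _) ⟨p * m, by rw [hm]; ring⟩
  obtain ⟨u, hu, hu'⟩ := exists_lowerAvg_of_not_dvd (e := e) (by rw [hm]; ring)
    (dvd_mul_right p m) hpe (h1 ▸ (hE f).1)
  rw [← h2] at hu
  have : E' f = u := IsOrthogonalProjector.apply_eq hV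
    (W := raisedSubmodule k q (q / (d * (e * p))) d) hE' hu fun w hw ↦ by
      rw [inner_lowerAvg V (h2 ▸ h3 ▸ dvd_mul_right _ _) hw hu', hE.inner_apply (hsub hw)]
  rw [this, inner_lowerAvg V (by rw [one_mul]) hw hu']

/-- A raised form of proper lower level is raised from level `q / p`, trivially or by `p`, for some
prime `p`. -/
theorem exists_prime_of_mem_raised {ℓ d : ℕ} (hℓ : ℓ ∣ q) (hne : ℓ ≠ q) (hd : d ∣ q / ℓ) {f : A k q}
    (hf : f ∈ raised k q ℓ d) :
    ∃ p : ℕ, p.Prime ∧ p ∣ q ∧ (f ∈ raised k q (q / p) p ∨ f ∈ raised k q (q / p) 1) := by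
  obtain ⟨c, hc⟩ := hℓ
  have hq0 : ℓ * c ≠ 0 := hc ▸ NeZero.ne q
  obtain ⟨hℓ0, hc0⟩ := mul_ne_zero_iff.1 hq0
  rw [hc, Nat.mul_div_cancel_left _ hℓ0.bot_lt] at hd
  obtain ⟨e, rfl⟩ := hd
  obtain ⟨hd0, he0⟩ := mul_ne_zero_iff.1 hc0
  have : NeZero d := ⟨hd0⟩
  obtain ⟨p, hp, hpde⟩ := Nat.exists_prime_and_dvd (n := d * e) fun h ↦ hne (by rw [hc, h, mul_one])
  have : NeZero p := ⟨hp.ne_zero⟩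
  refine ⟨p, hp, hc ▸ hpde.mul_left _, ?_⟩
  rcases hp.dvd_mul.1 hpde with ⟨a, rfl⟩ | ⟨a, rfl⟩
  · left
    have : NeZero a := ⟨(mul_ne_zero_iff.1 hd0).2⟩
    refine raised_mul_subset ?_ hf
    rw [hc, show ℓ * (p * a * e) = p * (a * ℓ * e) by ring, Nat.mul_div_cancel_left _ hp.pos]
    exact dvd_mul_right _ _
  · right
    rw [← one_mul d] at hf
    refine raised_mul_subset ?_ hf
    rw [hc, show ℓ * (d * (p * a)) = p * (d * ℓ * a) by ring, Nat.mul_div_cancel_left _ hp.pos]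
    exact dvd_mul_right _ _

theorem mem_newspace_iff (f : A k q) : f ∈ newspace V k q ↔ ∀ p : ℕ, p.Prime → p ∣ q →
    (∀ w ∈ raised k q (q / p) p, inner V w f = 0) ∧ ∀ w ∈ raised k q (q / p) 1, inner V w f = 0 := by
  constructor
  · intro h p hp hpq
    have hne : q / p ≠ q := (Nat.div_lt_self (NeZero.pos q) hp.one_lt).ne
    refine ⟨fun w hw ↦ h w (Submodule.subset_span ⟨q / p, p, Nat.div_dvd_of_dvd hpq, hne, ?_, hw⟩),
      fun w hw ↦ h w (Submodule.subset_span ⟨q / p, 1, Nat.div_dvd_of_dvd hpq, hne, one_dvd _, hw⟩)⟩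
    rw [Nat.div_div_self hpq (NeZero.ne q)]
  · intro h g hg
    induction hg using Submodule.span_induction with
    | mem g hg =>
      obtain ⟨ℓ, d, hℓ, hne, hd, hg⟩ := hg
      obtain ⟨p, hp, hpq, hg | hg⟩ := exists_prime_of_mem_raised hℓ hne hd hg
      exacts [(h p hp hpq).1 g hg, (h p hp hpq).2 g hg]
    | zero => exact inner_zero_left V f
    | add x y _ _ hx hy => rw [inner_add_left, hx, hy, add_zero]
    | smul c x _ hx => rw [inner_smul_left, hx, mul_zero]

/-- The Möbius combination of the projectors onto the raised spaces is the projector onto the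
newspace. -/
theorem isOrthogonalProjector_newspace (hV : 0 < V)
    (hcube : ∀ p : ℕ, p.Prime → p ∣ q → p ^ 3 ∣ q) (E : ℕ → ℕ → (A k q →ₗ[ℂ] A k q))
    (hE : ∀ d e : ℕ, d ∣ q → e ∣ q → Squarefree d → Squarefree e →
      IsOrthogonalProjector V (E d e) (raised k q (q / (d * e)) d)) :
    IsOrthogonalProjector V (∑ d ∈ q.divisors, ∑ e ∈ q.divisors,
      ((moebius d * moebius e : ℤ) : ℂ) • E d e) (newspace V k q) := by
  have hq := NeZero.ne q
  set P := ∑ d ∈ q.divisors, ∑ e ∈ q.divisors, ((moebius d * moebius e : ℤ) : ℂ) • E d e with hP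
  have hinner (w f : A k q) : inner V w (P f) = ∑ d ∈ q.divisors, ∑ e ∈ q.divisors,
      (moebius d : ℂ) * ((moebius e : ℂ) * inner V w (E d e f)) := by
    rw [← innerRight_apply, hP]
    simp only [LinearMap.sum_apply, LinearMap.smul_apply, map_sum, map_smul, smul_eq_mul,
      innerRight_apply]
    push_cast
    simp only [mul_assoc]
  have hmu {d : ℕ} (hd : ¬ Squarefree d) : (moebius d : ℂ) = 0 := by
    rw [ArithmeticFunction.moebius_eq_zero_of_not_squarefree hd, Int.cast_zero]
  intro f
  constructor
  · rw [mem_newspace_iff]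
    intro p hp hpq
    have hmul {d : ℕ} (hd : d ∣ q) (hds : Squarefree d) (hpd : ¬ p ∣ d) :
        d * p ∣ q ∧ Squarefree (d * p) := by
      have hcop : d.Coprime p := ((hp.coprime_iff_not_dvd).2 hpd).symm
      exact ⟨hcop.mul_dvd_of_dvd_of_dvd hd hpq,
        (Nat.squarefree_mul hcop).2 ⟨hds, hp.prime.squarefree⟩⟩
    constructor
    · intro w hw
      rw [hinner, Finset.sum_comm]
      refine Finset.sum_eq_zero fun e he ↦ ?_
      by_cases hes : Squarefree e
      · refine sum_moebius_mul_eq_zero hq hp hpq _ fun d hd hds hpd ↦ ?_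
        have heq := Nat.dvd_of_mem_divisors he
        obtain ⟨h1, h2⟩ := hmul hd hds hpd
        rw [(hE d e hd heq hds hes).inner_apply_mul_left hV hcube hp hpq hd heq hds hes hpd
          (hE (d * p) e h1 heq h2 hes) hw]
      · simp [hmu hes]
    · intro w hw
      rw [hinner]
      refine Finset.sum_eq_zero fun d hd ↦ ?_
      rw [← Finset.mul_sum]
      by_cases hds : Squarefree d
      · rw [sum_moebius_mul_eq_zero hq hp hpq _ fun e he hes hpe ↦ ?_, mul_zero]
        have hdq := Nat.dvd_of_mem_divisors hd
        obtain ⟨h1, h2⟩ := hmul he hes hpe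
        rw [(hE d e hdq he hds hes).inner_apply_mul_right hV hcube hp hpq hdq he hds hes hpe
          (hE d (e * p) hdq h1 hds h2) hw]
      · rw [hmu hds, zero_mul]
  · intro w hw
    -- The raised space for `d = e = 1` is all of level `q`.
    have h11 : E 1 1 f = f :=
      (hE 1 1 (one_dvd _) (one_dvd _) squarefree_one squarefree_one).apply_eq hV
        (W := raisedSubmodule k q (q / (1 * 1)) 1)
        (by
          rw [mem_raisedSubmodule, mul_one, Nat.div_one]
          exact ⟨f, (raise_one f).symm⟩) fun _ _ ↦ rfl
    have hold {d e : ℕ} (hd : d ∣ q) (he : e ∣ q) (hds : Squarefree d) (hes : Squarefree e)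
        (hne : d * e ≠ 1) : inner V w (E d e f) = 0 := by
      rw [← inner_conj_symm, hw, map_zero]
      have hde : d * e ∣ q := by
        simpa using mul_mul_dvd_of_squarefree hq hcube hds hes squarefree_one hd he (one_dvd _)
      refine Submodule.subset_span ⟨q / (d * e), d, Nat.div_dvd_of_dvd hde, ?_, ?_,
        (hE d e hd he hds hes f).1⟩
      · have : 0 < d * e := Nat.pos_of_dvd_of_pos hde (NeZero.pos q)
        exact (Nat.div_lt_self (NeZero.pos q) (by omega)).ne
      · rw [Nat.div_div_self hde hq]
        exact dvd_mul_right _ _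
    rw [inner_sub_right, hinner, Finset.sum_eq_single_of_mem 1 (by simp [hq]),
      Finset.sum_eq_single_of_mem 1 (by simp [hq])]
    · simp [h11]
    · intro e he hne
      by_cases hes : Squarefree e
      · rw [hold (one_dvd _) (Nat.dvd_of_mem_divisors he) squarefree_one hes (by simpa using hne)]
        simp
      · simp [hmu hes]
    · intro d hd hne
      refine Finset.sum_eq_zero fun e he ↦ ?_
      by_cases hds : Squarefree d
      · by_cases hes : Squarefree e
        · rw [hold (Nat.dvd_of_mem_divisors hd) (Nat.dvd_of_mem_divisors he) hds hes
            (fun h ↦ hne (Nat.eq_one_of_mul_eq_one_right h))]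
          simp
        · simp [hmu hes]
      · simp [hmu hds]

end Newspace

/-! ### Reproducing kernels -/

/-- Evaluation at a point as a linear form. -/
def evalLin {k ℓ : ℕ} (z : ℍ) : A k ℓ →ₗ[ℂ] ℂ where
  toFun f := f z
  map_add' _ _ := rfl
  map_smul' _ _ := rfl

theorem evalLin_apply {k ℓ : ℕ} (z : ℍ) (f : A k ℓ) : evalLin z f = f z := rfl

section Kernel

variable {k ℓ : ℕ} [NeZero ℓ] {V : ℝ} {B W : Set (A k ℓ)}

theorem IsOrthonormalBasis.sum_smul_inner (hB : IsOrthonormalBasis V B W) {s : Finset (A k ℓ)}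
    (hs : ↑s ⊆ B) (c : A k ℓ → ℂ) {ψ : A k ℓ} (hψ : ψ ∈ s) :
    inner V ψ (∑ φ ∈ s, c φ • φ) = c ψ := by
  rw [← innerRight_apply, map_sum, Finset.sum_eq_single_of_mem ψ hψ, map_smul, innerRight_apply,
    hB.1 ψ (hs hψ), smul_eq_mul, mul_one]
  intro φ hφ hne
  rw [map_smul, innerRight_apply, hB.2.1 ψ (hs hψ) φ (hs hφ) hne.symm, smul_zero]

theorem IsOrthonormalBasis.finite (hB : IsOrthonormalBasis V B W) : B.Finite := by
  have : LinearIndependent ℂ ((↑) : B → A k ℓ) := by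
    rw [linearIndependent_subtype_iff, linearIndepOn_iff']
    intro s g hs hg φ hφ
    have := hB.sum_smul_inner hs g hφ
    simp only [id] at hg
    rw [hg, ← innerRight_apply, map_zero] at this
    exact this.symm
  exact this.setFinite

theorem IsOrthonormalBasis.projector_apply (hV : 0 < V) (hB : IsOrthonormalBasis V B W)
    {E : A k ℓ →ₗ[ℂ] A k ℓ} (hE : IsOrthogonalProjector V E W) (f : A k ℓ) :
    E f = ∑ φ ∈ hB.finite.toFinset, inner V φ f • φ := by
  have hW := hB.2.2
  refine IsOrthogonalProjector.apply_eq hV (W := Submodule.span ℂ B) (hW.symm ▸ hE) ?_ ?_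
  · exact Submodule.sum_mem _ fun φ hφ ↦ Submodule.smul_mem _ _
      (Submodule.subset_span (hB.finite.mem_toFinset.1 hφ))
  · intro w hw
    induction hw using Submodule.span_induction with
    | mem ψ hψ =>
      exact hB.sum_smul_inner (by simp) (fun φ ↦ inner V φ f) (hB.finite.mem_toFinset.2 hψ)
    | zero =>
      rw [inner_zero_left, inner_zero_left]
    | add x y _ _ hx hy => rw [inner_add_left, inner_add_left, hx, hy]
    | smul c x _ hx => rw [inner_smul_left, inner_smul_left, hx]

/-- The reproducing kernel of a subspace in terms of its orthogonal projector. -/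
theorem IsOrthonormalBasis.kernel_eq (hV : 0 < V) (hB : IsOrthonormalBasis V B W)
    {E : A k ℓ →ₗ[ℂ] A k ℓ} (hE : IsOrthogonalProjector V E W) {B₀ : Set (A k ℓ)}
    (hB₀ : IsOrthonormalBasis V B₀ Set.univ) (z₁ z₂ : ℍ) :
    ∑ᶠ φ ∈ B, φ z₁ * conj (φ z₂) = ∑ ψ ∈ hB₀.finite.toFinset, E ψ z₁ * conj (ψ z₂) := by
  have hid : IsOrthogonalProjector V (LinearMap.id : A k ℓ →ₗ[ℂ] A k ℓ) Set.univ := fun f ↦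
    ⟨Set.mem_univ _, fun w _ ↦ by rw [LinearMap.id_apply, inner_sub_right, sub_self]⟩
  have heval (s : Finset (A k ℓ)) (c : A k ℓ → ℂ) (z : ℍ) :
      (∑ φ ∈ s, c φ • φ) z = ∑ φ ∈ s, c φ * φ z := by
    rw [← evalLin_apply, map_sum]
    rfl
  rw [finsum_mem_eq_finite_toFinset_sum _ hB.finite]
  have hleft : ∀ φ ∈ hB.finite.toFinset, φ z₁ * conj (φ z₂) =
      ∑ ψ ∈ hB₀.finite.toFinset, inner V φ ψ * φ z₁ * conj (ψ z₂) := by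
    intro φ _
    -- Only the conjugated factor is expanded in `B₀`; the coefficients then reassemble into `E ψ`
    -- after exchanging the sums.
    have h := hB₀.projector_apply hV hid φ
    rw [LinearMap.id_apply] at h
    have h' : φ z₂ = ∑ ψ ∈ hB₀.finite.toFinset, inner V ψ φ * ψ z₂ := by
      rw [← heval, ← h]
    rw [h', map_sum, Finset.mul_sum]
    refine Finset.sum_congr rfl fun ψ _ ↦ ?_
    rw [map_mul, inner_conj_symm]
    ring
  rw [Finset.sum_congr rfl hleft, Finset.sum_comm]
  refine Finset.sum_congr rfl fun ψ _ ↦ ?_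
  rw [hB.projector_apply hV hE ψ, heval, Finset.sum_mul]

end Kernel

theorem raiseLin_injective {k d ℓ q : ℕ} [NeZero d] [NeZero ℓ] [NeZero q] (h : d * ℓ ∣ q) :
    Function.Injective (raiseLin h : A k ℓ →ₗ[ℂ] A k q) := by
  refine (injective_iff_map_eq_zero _).2 fun φ hφ ↦ eq_zero_of_inner_self_eq_zero one_pos ?_
  rw [← inner_raiseLin h, hφ, ← innerRight_apply, map_zero]

theorem IsOrthonormalBasis.image_raiseLin {k d ℓ q : ℕ} [NeZero d] [NeZero ℓ] [NeZero q]
    (h : d * ℓ ∣ q) {V : ℝ} {B : Set (A k ℓ)} (hB : IsOrthonormalBasis V B Set.univ) :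
    IsOrthonormalBasis V (raiseLin h '' B) (raised k q ℓ d) := by
  refine ⟨?_, ?_, ?_⟩
  · rintro _ ⟨φ, hφ, rfl⟩
    rw [inner_raiseLin, hB.1 φ hφ]
  · rintro _ ⟨φ, hφ, rfl⟩ _ ⟨ψ, hψ, rfl⟩ hne
    rw [inner_raiseLin, hB.2.1 φ hφ ψ hψ fun h ↦ hne (by rw [h])]
  · rw [← Submodule.map_span]
    ext f
    rw [Submodule.map_coe, hB.2.2, Set.image_univ]
    constructor
    · rintro ⟨φ, rfl⟩
      exact ⟨φ, coe_raiseLin h φ⟩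
    · rintro ⟨φ, hφ⟩
      exact ⟨φ, DFunLike.coe_injective (by rw [coe_raiseLin, hφ])⟩

/-- The kernel of the newspace as a Möbius combination of raised kernels. -/
theorem kernel_newspace {k q : ℕ} [NeZero q] {V : ℝ} (hV : 0 < V)
    (hcube : ∀ p : ℕ, p.Prime → p ∣ q → p ^ 3 ∣ q) {Bnew : Set (A k q)}
    {B : (ℓ : ℕ) → Set (A k ℓ)} (hnew : IsOrthonormalBasis V Bnew (newspace V k q))
    (hB : ∀ ℓ : ℕ, ℓ ∣ q → IsOrthonormalBasis V (B ℓ) Set.univ) (z₁ z₂ : ℍ) :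
    ∑ᶠ φ ∈ Bnew, φ z₁ * conj (φ z₂) = ∑ d ∈ q.divisors, ∑ e ∈ q.divisors,
      ((moebius d * moebius e : ℤ) : ℂ) *
        ∑ᶠ φ ∈ B (q / (d * e)), raise d φ z₁ * conj (raise d φ z₂) := by
  choose E hE using fun d e : ℕ ↦
    exists_isOrthogonalProjector hV (raisedSubmodule k q (q / (d * e)) d)
  simp only [coe_raisedSubmodule] at hE
  have hP := isOrthogonalProjector_newspace hV hcube E fun d e _ _ _ _ ↦ hE d e
  -- Every kernel is written through the same basis `B q`, so the identity reduces to linearity in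
  -- the projector.
  rw [hnew.kernel_eq hV hP (hB q dvd_rfl)]
  have hsum (c : ℕ → ℕ → ℂ) (ψ : A k q) :
      (∑ d ∈ q.divisors, ∑ e ∈ q.divisors, c d e • E d e) ψ z₁ =
        ∑ d ∈ q.divisors, ∑ e ∈ q.divisors, c d e * E d e ψ z₁ := by
    rw [← evalLin_apply]
    simp only [LinearMap.sum_apply, LinearMap.smul_apply, map_sum, map_smul, smul_eq_mul,
      evalLin_apply]
  simp only [hsum, Finset.sum_mul]
  rw [Finset.sum_comm]
  refine Finset.sum_congr rfl fun d hd ↦ ?_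
  rw [Finset.sum_comm]
  refine Finset.sum_congr rfl fun e he ↦ ?_
  by_cases hsq : Squarefree d ∧ Squarefree e
  · have hde : d * e ∣ q := by
      simpa using mul_mul_dvd_of_squarefree (NeZero.ne q) hcube hsq.1 hsq.2 squarefree_one
        (Nat.dvd_of_mem_divisors hd) (Nat.dvd_of_mem_divisors he) (one_dvd _)
    have : NeZero d := ⟨hsq.1.ne_zero⟩
    have : NeZero (q / (d * e)) := ⟨(Nat.div_pos (Nat.le_of_dvd (NeZero.pos q) hde)
      (Nat.pos_of_dvd_of_pos hde (NeZero.pos q))).ne'⟩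
    have hdvd : d * (q / (d * e)) ∣ q :=
      (mul_dvd_mul_right (dvd_mul_right d e) _).trans (Nat.mul_div_cancel' hde).dvd
    have hker := ((hB _ (Nat.div_dvd_of_dvd hde)).image_raiseLin hdvd).kernel_eq hV (hE d e)
      (hB q dvd_rfl) z₁ z₂
    rw [finsum_mem_image (raiseLin_injective hdvd).injOn] at hker
    simp only [coe_raiseLin] at hker
    rw [hker, Finset.mul_sum]
    simp only [mul_assoc]
  · have : moebius d * moebius e = 0 := by
      rw [not_and_or] at hsq
      rcases hsq with h | h <;> simp [ArithmeticFunction.moebius_eq_zero_of_not_squarefree h]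
    simp [this]

end NewformKernel

end

theorem theorem1 (k : ℕ) (hk : 0 < k) (q : ℕ) (hq : 0 < q)
    (hcube : ∀ p : ℕ, p.Prime → p ∣ q → p ^ 3 ∣ q) (V : ℝ) (hV : 0 < V) :
    (∀ (Bnew : Set (NewformKernel.A k q)) (B : (ℓ : ℕ) → Set (NewformKernel.A k ℓ)),
      NewformKernel.IsOrthonormalBasis V Bnew (NewformKernel.newspace V k q) →
      (∀ ℓ : ℕ, ℓ ∣ q → NewformKernel.IsOrthonormalBasis V (B ℓ) Set.univ) →
      Bnew.Finite ∧ (∀ ℓ : ℕ, ℓ ∣ q → (B ℓ).Finite) ∧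
      ∀ z₁ z₂ : ℍ,
        ∑ᶠ φ ∈ Bnew, φ z₁ * conj (φ z₂) =
          ∑ d ∈ q.divisors, ∑ e ∈ q.divisors,
            ((ArithmeticFunction.moebius d * ArithmeticFunction.moebius e : ℤ) : ℂ) *
              ∑ᶠ φ ∈ B (q / (d * e)),
                NewformKernel.raise d φ z₁ * conj (NewformKernel.raise d φ z₂)) ∧
    (∀ d e : ℕ, d ∣ q → e ∣ q → Squarefree d → Squarefree e →
      ∃ E : NewformKernel.A k q →ₗ[ℂ] NewformKernel.A k q,
        NewformKernel.IsOrthogonalProjector V E (NewformKernel.raised k q (q / (d * e)) d)) ∧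
    (∀ E : ℕ → ℕ → (NewformKernel.A k q →ₗ[ℂ] NewformKernel.A k q),
      (∀ d e : ℕ, d ∣ q → e ∣ q → Squarefree d → Squarefree e →
        NewformKernel.IsOrthogonalProjector V (E d e)
          (NewformKernel.raised k q (q / (d * e)) d)) →
      NewformKernel.IsOrthogonalProjector V
        (∑ d ∈ q.divisors, ∑ e ∈ q.divisors,
          ((ArithmeticFunction.moebius d * ArithmeticFunction.moebius e : ℤ) : ℂ) • E d e)
        (NewformKernel.newspace V k q)) := by
  have : NeZero q := ⟨hq.ne'⟩
  refine ⟨fun Bnew B hnew hB ↦ ⟨hnew.finite, fun ℓ hℓ ↦ ?_,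
    NewformKernel.kernel_newspace hV hcube hnew hB⟩, fun d e _ _ _ _ ↦
    NewformKernel.exists_isOrthogonalProjector hV
      (NewformKernel.raisedSubmodule k q (q / (d * e)) d),
    NewformKernel.isOrthogonalProjector_newspace hV hcube⟩
  have : NeZero ℓ := ⟨(Nat.pos_of_dvd_of_pos hℓ hq).ne'⟩
  exact (hB ℓ hℓ).finite
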